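/- For a rational number $x$ and an integer $k\ge 0$ let $(x)_k=x(x+1)\cdots(x+k-1)$, with $(x)_0=1$, and for $\ell,m\ge 1$ let $H_m^{(\ell)}=\sum_{k=1}^m 1/k^{\ell}$. For rational numbers $a,b$, a prime $p$ and an integer $e\ge 0$, write $a\equiv b\pmod{p^e}$ if $a-b=p^e u/v$ for some integers $u,v$ with $p\nmid v$. Let $p$ be an odd prime, $s$ a positive integer, and $m=(p^s-1)/2$ or $m=p^s-1$. Then $$\sum_{k=0}^{m}(-1)^k(4k+1)\frac{(1/2)_k^5}{k!^5}\equiv \begin{cases} \dfrac{(1/2)_{(p^s-1)/4}^2}{(1)_{(p^s-1)/4}^2}\left\{p^s+\dfrac{p^{3s}}{4}H_{(p^s-1)/2}^{(2)}-\dfrac{p^{3s}}{8}H_{(p^s-1)/4}^{(2)}\right\}\pmod{p^{s+4}}, & \text{if } p^s\equiv 1\pmod 4,\\[12pt] p^{2s}\,\dfrac{(3/4)_{(p^s-1)/2}}{(5/4)_{(p^s-1)/2}}\pmod{p^{s+4}}, & \text{if } p^s\equiv 3\pmod 4. \end{cases}$$ -/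

import Mathlib

/-- The shifted factorial `(x)_k = x (x + 1) ⋯ (x + k - 1)` of a rational number `x`
(equal to `Γ(x + k) / Γ(x)` whenever `x` is not a pole of `Γ`). -/
noncomputable def shiftedFactorial (x : ℚ) (k : ℕ) : ℚ := (ascPochhammer ℚ k).eval x

/-- The harmonic number of order `l`: `H_m^{(l)} = ∑_{k=1}^m 1 / k^l`. -/
def harmonicOrder (l m : ℕ) : ℚ := ∑ k ∈ Finset.Icc 1 m, 1 / (k : ℚ) ^ l

/-- Congruence `a ≡ b (mod p^e)` of rational numbers: `a - b` is `p^e` times a rational number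
`u / v` whose denominator `v` is not divisible by `p` (so `v ≠ 0` in particular). -/
def RatModEq (p e : ℕ) (a b : ℚ) : Prop :=
  ∃ u v : ℤ, ¬ (p : ℤ) ∣ v ∧ a - b = (p : ℚ) ^ e * ((u : ℚ) / (v : ℚ))

/-- The sum `∑_{k=0}^m (-1)^k (4k + 1) (1/2)_k^5 / k!^5`. -/
noncomputable def ramanujanPartialSum (m : ℕ) : ℚ :=
  ∑ k ∈ Finset.range (m + 1),
    (-1 : ℚ) ^ k * (4 * (k : ℚ) + 1) *
      (shiftedFactorial (1 / 2) k ^ 5 / (k.factorial : ℚ) ^ 5)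

/-!
Let `M = (p ^ s - 1) / 2`, `h_k = (1/2)_k / k!`, and write `r_z(k)` for the product over `i < k` of
`((i + 1/2) ^ 2 - z) / ((i + 1) ^ 2 - z)`, so that `r_0(k) = h_k ^ 2`. For `y = (M + 1/2) ^ 2` the
very-well-poised sum of `(-1) ^ k (4k + 1) h_k r_y(k) r_z(k)` terminates at `k = M`, and telescoping
in steps `M ↦ M + 2` gives it a closed form. By `x² = 2xy - y² + (x - y)²`, the sum of
`(-1) ^ k (4k + 1) h_k ^ 5` over `k ≤ M` is twice this sum at `z = 0` minus its value at `z = y`, up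
to an error quadratic in `r_0 - r_y`. As `y = (p ^ s / 2) ^ 2`, the quotient `r_y(k) / h_k ^ 2` is
`1 - p ^ 2 δ_k` with `δ_k` a `p`-adic integer, so the error carries a factor `p ^ 4`; so do the
terms with `M < k < p ^ s`, in which `p` divides `h_k`.

The remaining factor `p ^ s` comes from a `q`-analogue over the localization of `ℤ[q]` at
`(p, q - 1)`. When `q` is a primitive root of unity of order `p ^ i` with `1 ≤ i ≤ s`, the terms in
the second half of each block of `p ^ i` consecutive indices vanish, and those in the first half
cancel in pairs by reflection, a symmetry which the weights `δ_k` respect. Hence the `q`-sum is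
divisible by the product of the cyclotomic polynomials of orders `p ^ i`, whose value at `q = 1` is
`p ^ s`.
-/

open Finset Polynomial

/-! ### Very-well-poised sums -/

section WellPoisedSum

variable {K : Type*} [Field K]

/-- The ratio `(1/2)_k / k!`. -/
def halfRatio (K : Type*) [Field K] (k : ℕ) : K :=
  ∏ i ∈ range k, ((i : K) + 1 / 2) / (i + 1)

/-- The ratio `(1/2 + a)_k (1/2 - a)_k / ((1 + a)_k (1 - a)_k)` as a function of `z = a ^ 2`. -/
def pairRatio (z : K) (k : ℕ) : K :=
  ∏ i ∈ range k, (((i : K) + 1 / 2) ^ 2 - z) / (((i : K) + 1) ^ 2 - z)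

/-- The `k`-th term of the very-well-poised series with parameters `1/2, 1/2, 1/2 ± a, 1/2 ± √z`. -/
def wellPoisedTerm (a z : K) (k : ℕ) : K :=
  (-1) ^ k * (4 * k + 1) * halfRatio K k * pairRatio (a ^ 2) k * pairRatio z k

/-- The very-well-poised series which the choice `a = M + 1/2` makes terminate at `k = M`. -/
def wellPoisedSum (M : ℕ) (z : K) : K :=
  ∑ k ∈ range (M + 1), wellPoisedTerm ((M : K) + 1 / 2) z k

lemma halfRatio_succ (k : ℕ) :
    halfRatio K (k + 1) = halfRatio K k * (((k : K) + 1 / 2) / (k + 1)) :=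
  prod_range_succ _ _

lemma pairRatio_succ (z : K) (k : ℕ) : pairRatio z (k + 1) =
    pairRatio z k * ((((k : K) + 1 / 2) ^ 2 - z) / (((k : K) + 1) ^ 2 - z)) :=
  prod_range_succ _ _

lemma pairRatio_zero_left (k : ℕ) : pairRatio (0 : K) k = halfRatio K k ^ 2 := by
  simp only [pairRatio, halfRatio, sub_zero, ← div_pow, prod_pow]

lemma pairRatio_eq_zero {M k : ℕ} (h : M < k) : pairRatio (((M : K) + 1 / 2) ^ 2) k = 0 :=
  prod_eq_zero (mem_range.mpr h) (by rw [sub_self, zero_div])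

lemma wellPoisedSum_eq_sum_range {M N : ℕ} (h : M < N) (z : K) :
    wellPoisedSum M z = ∑ k ∈ range N, wellPoisedTerm ((M : K) + 1 / 2) z k := by
  refine sum_subset (range_subset_range.mpr h) fun k _ hk ↦ ?_
  rw [wellPoisedTerm, pairRatio_eq_zero (by simpa using hk), mul_zero, zero_mul]

/-- The Gosper certificate for the step `a ↦ a + 2` of the very-well-poised series. -/
def wellPoisedCertificate (a z : K) (k : ℕ) : K :=
  (-1) ^ k * halfRatio K k * pairRatio ((a + 2) ^ 2) k * pairRatio z k *
    (-16 * a * (a + 1) * k * (k ^ 2 - z) * (k + a + 2) /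
      ((2 * (k + a) + 1) * (2 * (k + a) + 3) * (k - 1 - a)))

variable [CharZero K] {a z : K}

lemma pairRatio_sq_add_two (ha : ∀ i : ℤ, a ≠ i) (k : ℕ) :
    pairRatio (a ^ 2) k *
        ((2 * (k + a) + 1) * (2 * (k + a) + 3) * (k - 1 - a) * (k - a) * (a + 2)) =
      pairRatio ((a + 2) ^ 2) k *
        ((2 * (k - a) - 3) * (2 * (k - a) - 1) * (k + a + 1) * (k + a + 2) * a) := by
  induction k with
  | zero => simp only [pairRatio, range_zero, prod_empty]; push_cast; ring
  | succ k ih =>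
    have h₁ : (k : K) + 1 + a ≠ 0 := fun h ↦ ha (-(k + 1)) (by push_cast; linear_combination h)
    have h₂ : (k : K) + 1 - a ≠ 0 := fun h ↦ ha (k + 1) (by push_cast; linear_combination -h)
    have h₃ : (k : K) - 1 - a ≠ 0 := fun h ↦ ha (k - 1) (by push_cast; linear_combination -h)
    have h₄ : (k : K) + 1 + (a + 2) ≠ 0 := fun h ↦
      ha (-(k + 3)) (by push_cast; linear_combination h)
    have h₅ : (k : K) + 1 - (a + 2) ≠ 0 := by convert h₃ using 1; ring
    rw [pairRatio_succ, pairRatio_succ, sq_sub_sq, sq_sub_sq, sq_sub_sq, sq_sub_sq]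
    push_cast
    linear_combination (norm := (field_simp; ring))
      ((k + 1 / 2 - a) * (k + a + 5 / 2) / ((k + 1 + a) * (k - 1 - a))) * ih

lemma wellPoisedCertificate_succ (ha : ∀ i : ℤ, a ≠ i)
    (ha' : ∀ i : ℕ, 2 * ((i : K) + a) + 1 ≠ 0) (hz : ∀ i : ℕ, ((i : K) + 1) ^ 2 ≠ z) (k : ℕ) :
    wellPoisedCertificate a z (k + 1) =
      (-1) ^ k * halfRatio K k * pairRatio ((a + 2) ^ 2) k * pairRatio z k *
        (2 * a * (a + 1) * (2 * k + 1) * ((k + 1 / 2) ^ 2 - z) * (2 * (k - a) - 3) /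
          ((2 * (k + a) + 3) * (k - 1 - a) * (k - a))) := by
  have h₁ : (k : K) + 1 ≠ 0 := k.cast_add_one_ne_zero
  have h₂ : (k : K) - a ≠ 0 := fun h ↦ ha k (by push_cast; linear_combination -h)
  have h₃ : (k : K) - 1 - a ≠ 0 := fun h ↦ ha (k - 1) (by push_cast; linear_combination -h)
  have h₄ : (k : K) + 3 + a ≠ 0 := fun h ↦ ha (-(k + 3)) (by push_cast; linear_combination h)
  have h₅ : 2 * ((k : K) + a) + 3 ≠ 0 := by convert ha' (k + 1) using 1; push_cast; ring
  have h₆ : 2 * ((k : K) + a) + 5 ≠ 0 := by convert ha' (k + 2) using 1; push_cast; ring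
  have hzk : ((k : K) + 1) ^ 2 - z ≠ 0 := sub_ne_zero.mpr (hz k)
  have e₁ : ((k : K) + 1) ^ 2 - (a + 2) ^ 2 = (k + 3 + a) * (k - 1 - a) := by ring
  have e₂ : (2 * ((k : K) + 1 + a) + 1) * (2 * (k + 1 + a) + 3) * (k + 1 - 1 - a) =
    (2 * (k + a) + 3) * (2 * (k + a) + 5) * (k - a) := by ring
  simp only [wellPoisedCertificate, halfRatio_succ, pairRatio_succ, pow_succ (-1 : K) k]
  push_cast
  rw [e₁, e₂]
  generalize pairRatio ((a + 2) ^ 2) k = P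
  field_simp
  ring

lemma wellPoisedTerm_telescope (ha : ∀ i : ℤ, a ≠ i)
    (ha' : ∀ i : ℕ, 2 * ((i : K) + a) + 1 ≠ 0) (hz : ∀ i : ℕ, ((i : K) + 1) ^ 2 ≠ z) (k : ℕ) :
    a * ((a + 3 / 2) ^ 2 - z) * wellPoisedTerm (a + 2) z k -
        (a + 2) * ((a + 1 / 2) ^ 2 - z) * wellPoisedTerm a z k =
      wellPoisedCertificate a z (k + 1) - wellPoisedCertificate a z k := by
  have h₁ : (k : K) - a ≠ 0 := fun h ↦ ha k (by push_cast; linear_combination -h)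
  have h₂ : (k : K) - 1 - a ≠ 0 := fun h ↦ ha (k - 1) (by push_cast; linear_combination -h)
  have h₃ : 2 * ((k : K) + a) + 1 ≠ 0 := ha' k
  have h₄ : 2 * ((k : K) + a) + 3 ≠ 0 := by convert ha' (k + 1) using 1; push_cast; ring
  have hP : (a + 2) * pairRatio (a ^ 2) k = pairRatio ((a + 2) ^ 2) k *
      ((2 * (k - a) - 3) * (2 * (k - a) - 1) * (k + a + 1) * (k + a + 2) * a /
        ((2 * (k + a) + 1) * (2 * (k + a) + 3) * (k - 1 - a) * (k - a))) := by
    rw [mul_div_assoc', eq_div_iff (by positivity), ← pairRatio_sq_add_two ha]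
    ring
  rw [wellPoisedCertificate_succ ha ha' hz]
  simp only [wellPoisedTerm, wellPoisedCertificate]
  linear_combination (norm := skip) (-((a + 1 / 2) ^ 2 - z) * (-1) ^ k * (4 * k + 1) *
    halfRatio K k * pairRatio z k) * hP
  generalize pairRatio ((a + 2) ^ 2) k = P, pairRatio (a ^ 2) k = P'
  field_simp
  ring

lemma natCast_add_half_ne_intCast (M : ℕ) (i : ℤ) : (M : K) + 1 / 2 ≠ i := fun h ↦ by
  have : (2 * M + 1 : K) = 2 * i := by linear_combination 2 * h
  have : (2 * M + 1 : ℤ) = 2 * i := by exact_mod_cast this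
  omega

lemma wellPoisedSum_add_two (hz : ∀ i : ℕ, ((i : K) + 1) ^ 2 ≠ z) (M : ℕ) :
    (2 * M + 1) * ((M + 2) ^ 2 - z) * wellPoisedSum (M + 2) z =
      (2 * M + 5) * ((M + 1) ^ 2 - z) * wellPoisedSum M z := by
  have h_int : ∀ i : ℤ, (M : K) + 1 / 2 ≠ i := natCast_add_half_ne_intCast M
  have h_half (i : ℕ) : 2 * ((i : K) + (M + 1 / 2)) + 1 ≠ 0 := by
    have : ((2 * (i + M) + 2 : ℕ) : K) ≠ 0 := Nat.cast_ne_zero.mpr (by omega)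
    convert this using 1
    push_cast
    ring
  have h_zero : wellPoisedCertificate ((M : K) + 1 / 2) z (M + 3) = 0 := by
    have h := pairRatio_eq_zero (K := K) (Nat.lt_succ_self (M + 2))
    have e : (M : K) + 1 / 2 + 2 = ((M + 2 : ℕ) : K) + 1 / 2 := by push_cast; ring
    rw [wellPoisedCertificate, e, h, mul_zero, zero_mul, zero_mul]
  have h_sum := sum_range_sub (wellPoisedCertificate ((M : K) + 1 / 2) z) (M + 3)
  simp only [← wellPoisedTerm_telescope h_int h_half hz, sum_sub_distrib, ← mul_sum] at h_sum
  rw [wellPoisedSum_eq_sum_range (Nat.lt_succ_self (M + 2)),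
    wellPoisedSum_eq_sum_range (show M < M + 3 by omega)]
  have e : ((M + 2 : ℕ) : K) + 1 / 2 = M + 1 / 2 + 2 := by push_cast; ring
  rw [e]
  have h_start : wellPoisedCertificate ((M : K) + 1 / 2) z 0 = 0 := by
    simp [wellPoisedCertificate]
  rw [h_zero, h_start] at h_sum
  linear_combination 2 * h_sum

lemma wellPoisedSum_even (hz : ∀ i : ℕ, ((i : K) + 1) ^ 2 ≠ z) (N : ℕ) :
    wellPoisedSum (2 * N) z = (4 * N + 1) * pairRatio (z / 4) N := by
  induction N with
  | zero => simp [wellPoisedSum, wellPoisedTerm, halfRatio, pairRatio]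
  | succ N ih =>
    have h := wellPoisedSum_add_two hz (2 * N)
    have h₁ : (2 * (2 * N : ℕ) + 1 : K) ≠ 0 := by
      exact_mod_cast (2 * (2 * N)).succ_ne_zero
    have h₂ : (((2 * N : ℕ) : K) + 2) ^ 2 - z ≠ 0 := by
      convert sub_ne_zero.mpr (hz (2 * N + 1)) using 1; push_cast; ring
    have h₃ : ((N : K) + 1) ^ 2 - z / 4 ≠ 0 := fun h ↦ h₂ (by push_cast; linear_combination 4 * h)
    rw [ih] at h
    refine mul_left_cancel₀ (mul_ne_zero h₁ h₂) (h.trans ?_)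
    rw [pairRatio_succ]
    push_cast
    linear_combination -4 * (4 * N + 5) * (4 * N + 1) * pairRatio (z / 4) N *
      div_mul_cancel₀ (((N : K) + 1 / 2) ^ 2 - z / 4) h₃

lemma wellPoisedSum_odd (hz : ∀ i : ℕ, ((i : K) + 1) ^ 2 ≠ z) (N : ℕ) :
    wellPoisedSum (2 * N + 1) z = (4 * N + 3) * (z / (1 - z)) *
      ∏ i ∈ range N, ((2 * (i : K) + 2) ^ 2 - z) / ((2 * i + 3) ^ 2 - z) := by
  induction N with
  | zero =>
    have h : 1 - z ≠ 0 := by simpa using sub_ne_zero.mpr (hz 0)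
    simp only [wellPoisedSum, wellPoisedTerm, halfRatio, pairRatio, sum_range_succ,
      prod_range_succ, range_zero, sum_empty, prod_empty]
    norm_num
    field_simp
    ring
  | succ N ih =>
    have h := wellPoisedSum_add_two hz (2 * N + 1)
    have h₁ : (2 * (2 * N + 1 : ℕ) + 1 : K) ≠ 0 := by
      exact_mod_cast (2 * (2 * N + 1)).succ_ne_zero
    have h₂ : (((2 * N + 1 : ℕ) : K) + 2) ^ 2 - z ≠ 0 := by
      convert sub_ne_zero.mpr (hz (2 * N + 2)) using 1; push_cast; ring
    have h₃ : (2 * (N : K) + 3) ^ 2 - z ≠ 0 := by convert h₂ using 1; push_cast; ring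
    rw [ih] at h
    refine mul_left_cancel₀ (mul_ne_zero h₁ h₂) (h.trans ?_)
    rw [prod_range_succ]
    push_cast
    linear_combination -(4 * N + 7) * (4 * N + 3) * (z / (1 - z)) *
      (∏ i ∈ range N, ((2 * (i : K) + 2) ^ 2 - z) / ((2 * i + 3) ^ 2 - z)) *
      div_mul_cancel₀ ((2 * (N : K) + 2) ^ 2 - z) h₃

end WellPoisedSum

/-! ### `q`-analogues at roots of unity -/

section QInteger

variable {R S : Type*} [CommRing R] [CommRing S]

/-- The `q`-integer `[n] = 1 + q + ⋯ + q ^ (n - 1)`. -/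
def qNat (q : R) (n : ℕ) : R := ∑ i ∈ range n, q ^ i

/-- The `q`-factorial `[n]! = [1] [2] ⋯ [n]`. -/
def qFactorial (q : R) (n : ℕ) : R := ∏ i ∈ range n, qNat q (i + 1)

/-- `C` satisfies the recurrence of the `q`-analogue `(q; q²)_k / (q²; q²)_k` of `(1/2)_k / k!`. -/
def IsQHalfRatio (q : R) (C : ℕ → R) : Prop :=
  ∀ k, C (k + 1) * qNat q (2 * k + 2) = C k * qNat q (2 * k + 1)

/-- The `q`-analogue of the very-well-poised factor `(-1) ^ k (4k + 1)`. -/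
def qWellPoisedWeight (q : R) (k : ℕ) : R := (-1) ^ k * q ^ (k ^ 2 + k) * qNat q (4 * k + 1)

lemma qNat_add (q : R) (a b : ℕ) : qNat q (a + b) = qNat q a + q ^ a * qNat q b := by
  simp only [qNat, sum_range_add, mul_sum, pow_add]

lemma qNat_mul (q : R) (a b : ℕ) : qNat q (a * b) = qNat q a * qNat (q ^ a) b := by
  induction b with
  | zero => simp [qNat]
  | succ b ih => rw [mul_add_one, qNat_add, ih, qNat_add (q ^ a), pow_mul]; simp [qNat]; ring

lemma qNat_one_left (n : ℕ) : qNat (1 : R) n = n := by simp [qNat]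

lemma map_qNat (φ : R →+* S) (q : R) (n : ℕ) : φ (qNat q n) = qNat (φ q) n := by simp [qNat]

lemma map_qWellPoisedWeight (φ : R →+* S) (q : R) (k : ℕ) :
    φ (qWellPoisedWeight q k) = qWellPoisedWeight (φ q) k := by
  simp [qWellPoisedWeight, map_qNat]

lemma qWellPoisedWeight_one_left (k : ℕ) :
    qWellPoisedWeight (1 : R) k = (-1) ^ k * (4 * k + 1) := by
  simp [qWellPoisedWeight, qNat_one_left]

lemma qFactorial_succ (q : R) (n : ℕ) :
    qFactorial q (n + 1) = qFactorial q n * qNat q (n + 1) :=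
  prod_range_succ _ _

lemma qFactorial_mul_qFactorial_dvd (q : R) (n k : ℕ) :
    qFactorial q n * qFactorial q k ∣ qFactorial q (n + k) := by
  induction h : n + k generalizing n k with
  | zero => obtain ⟨rfl, rfl⟩ := Nat.add_eq_zero_iff.mp h; simp [qFactorial]
  | succ N ih =>
    rcases n with _ | n
    · obtain rfl : k = N + 1 := by omega
      simp [qFactorial]
    rcases k with _ | k
    · obtain rfl : n = N := by omega
      simp [qFactorial]
    have h_left := mul_dvd_mul_right (ih (n + 1) k (by omega)) (qNat q (k + 1))
    have h_right := mul_dvd_mul_right (ih n (k + 1) (by omega)) (qNat q (n + 1))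
    have e : N + 1 = k + 1 + (n + 1) := by omega
    rw [qFactorial_succ q N, e, qNat_add, mul_add]
    refine dvd_add ?_ ?_
    · rwa [qFactorial_succ q k, ← mul_assoc]
    · rw [qFactorial_succ q n, mul_right_comm, mul_left_comm]
      exact h_right.mul_left _

lemma qFactorial_two_mul (q : R) (k : ℕ) : qFactorial q (2 * k) =
    (∏ i ∈ range k, qNat q (2 * i + 2)) * ∏ i ∈ range k, qNat q (2 * i + 1) := by
  induction k with
  | zero => simp [qFactorial]
  | succ k ih =>
    rw [mul_add_one, qFactorial_succ, qFactorial_succ, ih, prod_range_succ, prod_range_succ]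
    ring

lemma IsQHalfRatio.map {q : R} {C : ℕ → R} (hC : IsQHalfRatio q C) (φ : R →+* S) :
    IsQHalfRatio (φ q) fun k ↦ φ (C k) := fun k ↦ by
  simpa only [map_mul, map_qNat] using congrArg φ (hC k)

lemma IsQHalfRatio.mul_prod_eq {q : R} {C : ℕ → R} (hC : IsQHalfRatio q C) (k : ℕ) :
    C k * ∏ i ∈ range k, qNat q (2 * i + 2) = C 0 * ∏ i ∈ range k, qNat q (2 * i + 1) := by
  induction k with
  | zero => simp
  | succ k ih =>
    rw [prod_range_succ, prod_range_succ]
    linear_combination (∏ i ∈ range k, qNat q (2 * i + 2)) * hC k + qNat q (2 * k + 1) * ih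

lemma IsQHalfRatio.eq_halfRatio {K : Type*} [Field K] [CharZero K] {C : ℕ → K}
    (hC : IsQHalfRatio 1 C) (h_zero : C 0 = 1) (k : ℕ) : C k = halfRatio K k := by
  induction k with
  | zero => simpa [halfRatio] using h_zero
  | succ k ih =>
    have h := hC k
    have hk : (k : K) + 1 ≠ 0 := k.cast_add_one_ne_zero
    rw [qNat_one_left, qNat_one_left, ih] at h
    push_cast at h
    rw [halfRatio_succ, ← mul_div_assoc, eq_div_iff hk]
    linear_combination h / 2

end QInteger

section RootsOfUnity

variable {K : Type*} [Field K] {ζ : K} {m : ℕ}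

/-- The weight `x` is symmetric on the first half of each block of length `2m + 1`. -/
def IsBlockSymmetric (m : ℕ) (x : ℕ → K) : Prop :=
  ∀ l, ∀ r ≤ m, x ((2 * m + 1) * l + (m - r)) = x ((2 * m + 1) * l + r)

lemma pow_add_mul_of_pow_eq_one {d : ℕ} (h : ζ ^ d = 1) (a b : ℕ) : ζ ^ (d * b + a) = ζ ^ a := by
  rw [pow_add, pow_mul, h, one_pow, one_mul]

lemma qNat_ne_zero_of_not_dvd {d k : ℕ} (hζ : IsPrimitiveRoot ζ d) (hk : ¬ d ∣ k) :
    qNat ζ k ≠ 0 := fun h ↦ hk <| (hζ.pow_eq_one_iff_dvd k).mp <| by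
  rw [← sub_eq_zero, ← geom_sum_mul ζ k, ← qNat, h, zero_mul]

lemma qNat_mul_eq_zero {d : ℕ} (hζ : IsPrimitiveRoot ζ d) (hd : 1 < d) (b : ℕ) :
    qNat ζ (d * b) = 0 := by
  rw [qNat_mul, qNat, hζ.geom_sum_eq_zero hd, zero_mul]

lemma qNat_mul_add {d : ℕ} (hζ : IsPrimitiveRoot ζ d) (hd : 1 < d) (a b : ℕ) :
    qNat ζ (d * b + a) = qNat ζ a := by
  rw [qNat_add, qNat_mul_eq_zero hζ hd, pow_mul, hζ.pow_eq_one, one_pow, zero_add, one_mul]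

lemma qNat_mul_pow_eq_neg {d a b : ℕ} (hζ : IsPrimitiveRoot ζ d) (hd : 1 < d)
    (hab : d ∣ a + b) : qNat ζ a * ζ ^ b = -qNat ζ b := by
  obtain ⟨c, hc⟩ := hab
  have h := qNat_mul_eq_zero hζ hd c
  rw [← hc, add_comm, qNat_add] at h
  linear_combination h

lemma qNat_two_mul_add_two_ne_zero (hζ : IsPrimitiveRoot ζ (2 * m + 1)) {i : ℕ}
    (hi : i < 2 * m) : qNat ζ (2 * i + 2) ≠ 0 := by
  refine qNat_ne_zero_of_not_dvd hζ fun h ↦ ?_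
  have h_coprime : (2 * m + 1).Coprime 2 := by simp
  have h_dvd : 2 * m + 1 ∣ i + 1 := h_coprime.dvd_of_dvd_mul_left h
  exact absurd (Nat.le_of_dvd i.succ_pos h_dvd) (by omega)

lemma IsQHalfRatio.eq_zero {C : ℕ → K} (hC : IsQHalfRatio ζ C)
    (hζ : IsPrimitiveRoot ζ (2 * m + 1)) {k : ℕ} (hmk : m < k) (hk : k ≤ 2 * m) : C k = 0 := by
  have h_num : ∏ i ∈ range k, qNat ζ (2 * i + 1) = 0 :=
    prod_eq_zero (mem_range.mpr hmk) (hζ.geom_sum_eq_zero (by omega))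
  have h_den : ∏ i ∈ range k, qNat ζ (2 * i + 2) ≠ 0 := prod_ne_zero_iff.mpr fun i hi ↦
    qNat_two_mul_add_two_ne_zero hζ (by have := mem_range.mp hi; omega)
  refine (mul_eq_zero.mp ?_).resolve_right h_den
  rw [hC.mul_prod_eq, h_num, mul_zero]

variable (hζ : IsPrimitiveRoot ζ (2 * m + 1)) (hm : 0 < m)

include hζ hm

lemma prod_qNat_odd_mul_pow : (∏ i ∈ range m, qNat ζ (2 * i + 1)) * ζ ^ (m * (m + 1)) =
    (-1) ^ m * ∏ i ∈ range m, qNat ζ (2 * i + 2) := by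
  have h_pow (n : ℕ) : ζ ^ (n * (n + 1)) = ∏ i ∈ range n, ζ ^ (2 * i + 2) := by
    induction n with
    | zero => simp
    | succ n ih => rw [prod_range_succ, ← ih, ← pow_add]; congr 1; ring
  have h_neg : ∏ i ∈ range m, -qNat ζ (2 * i + 2) =
      (-1) ^ m * ∏ i ∈ range m, qNat ζ (2 * i + 2) := by
    rw [prod_neg, card_range]
  rw [← prod_range_reflect, h_pow, ← prod_mul_distrib, ← h_neg]
  refine prod_congr rfl fun i hi ↦ ?_
  have := mem_range.mp hi
  exact qNat_mul_pow_eq_neg hζ (by omega) ⟨1, by omega⟩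

lemma IsQHalfRatio.apply_half {C : ℕ → K} (hC : IsQHalfRatio ζ C) :
    C m * ζ ^ (m * (m + 1)) = (-1) ^ m * C 0 := by
  have h_den : ∏ i ∈ range m, qNat ζ (2 * i + 2) ≠ 0 := prod_ne_zero_iff.mpr fun i hi ↦
    qNat_two_mul_add_two_ne_zero hζ (by have := mem_range.mp hi; omega)
  refine mul_right_cancel₀ h_den ?_
  linear_combination ζ ^ (m * (m + 1)) * hC.mul_prod_eq m + C 0 * prod_qNat_odd_mul_pow hζ hm

lemma IsQHalfRatio.reflect {C : ℕ → K} (hC : IsQHalfRatio ζ C) {r : ℕ} (hr : r ≤ m) :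
    C (m - r) * ζ ^ (m * (m + 1)) = (-1) ^ m * ζ ^ r * C r := by
  induction r with
  | zero => simpa using hC.apply_half hζ hm
  | succ r ih =>
    obtain ⟨t, rfl⟩ := Nat.exists_eq_add_of_le hr
    have h_prev := ih (by omega)
    rw [show r + 1 + t - r = t + 1 by omega] at h_prev
    rw [Nat.add_sub_cancel_left]
    have h_even : qNat ζ (2 * t + 2) * ζ ^ (2 * r + 1) = -qNat ζ (2 * r + 1) :=
      qNat_mul_pow_eq_neg hζ (by omega) ⟨1, by ring⟩
    have h_odd : qNat ζ (2 * t + 1) * ζ ^ (2 * r + 2) = -qNat ζ (2 * r + 2) :=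
      qNat_mul_pow_eq_neg hζ (by omega) ⟨1, by ring⟩
    refine mul_right_cancel₀ (qNat_two_mul_add_two_ne_zero hζ (i := r) (by omega)) ?_
    generalize ζ ^ ((r + 1 + t) * (r + 1 + t + 1)) = κ at *
    linear_combination C t * κ * h_odd + ζ ^ (2 * r + 2) * κ * hC t -
      C (t + 1) * κ * ζ * h_even + ζ * qNat ζ (2 * r + 1) * h_prev -
      (-1) ^ (r + 1 + t) * ζ ^ (r + 1) * hC r

lemma qWellPoisedWeight_reflect {r : ℕ} (hr : r ≤ m) :
    qWellPoisedWeight ζ (m - r) * ζ ^ (5 * r + 1) =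
      -((-1) ^ m * ζ ^ (m * (m + 1)) * qWellPoisedWeight ζ r) := by
  obtain ⟨t, rfl⟩ := Nat.exists_eq_add_of_le hr
  have h_nat : qNat ζ (4 * t + 1) * ζ ^ (4 * r + 1) = -qNat ζ (4 * r + 1) :=
    qNat_mul_pow_eq_neg hζ (by omega) ⟨2, by ring⟩
  have h_pow : ζ ^ ((r + t) * (r + t + 1)) * ζ ^ (r ^ 2 + r) = ζ ^ (t ^ 2 + t) * ζ ^ r := by
    rw [← pow_add, ← pow_add, ← pow_add_mul_of_pow_eq_one hζ.pow_eq_one (t ^ 2 + t + r) r]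
    congr 1
    ring
  have h_sign : (-1 : K) ^ (r + t) * (-1) ^ r = (-1) ^ t := by
    rw [pow_add, mul_right_comm, ← pow_add, ← two_mul, pow_mul, neg_one_sq, one_pow, one_mul]
  simp only [qWellPoisedWeight, Nat.add_sub_cancel_left]
  linear_combination (-1) ^ t * ζ ^ (t ^ 2 + t) * ζ ^ r * h_nat +
    (-1) ^ (r + t) * (-1) ^ r * qNat ζ (4 * r + 1) * h_pow +
    ζ ^ (t ^ 2 + t) * ζ ^ r * qNat ζ (4 * r + 1) * h_sign

lemma IsQHalfRatio.weight_mul_pow_five_reflect {C : ℕ → K} (hC : IsQHalfRatio ζ C) {r : ℕ}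
    (hr : r ≤ m) : qWellPoisedWeight ζ (m - r) * C (m - r) ^ 5 =
      -(qWellPoisedWeight ζ r * C r ^ 5) := by
  have hζ₀ : ζ ≠ 0 := hζ.ne_zero (by omega)
  have h_period : ζ ^ (4 * (m * (m + 1)) + 1) = 1 := by
    rw [show 4 * (m * (m + 1)) + 1 = (2 * m + 1) * (2 * m + 1) by ring, pow_mul, hζ.pow_eq_one,
      one_pow]
  have h_sign : ((-1 : K) ^ m) ^ 6 = 1 := by rw [← pow_mul, mul_comm, pow_mul]; norm_num
  refine mul_right_cancel₀ (pow_ne_zero (5 * r + 1 + 5 * (m * (m + 1))) hζ₀) ?_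
  calc _ = (qWellPoisedWeight ζ (m - r) * ζ ^ (5 * r + 1)) *
        (C (m - r) * ζ ^ (m * (m + 1))) ^ 5 := by ring
    _ = -(qWellPoisedWeight ζ r * C r ^ 5) * (ζ ^ (m * (m + 1)) * ζ ^ (5 * r)) := by
      rw [qWellPoisedWeight_reflect hζ hm hr, hC.reflect hζ hm hr]
      linear_combination -ζ ^ (m * (m + 1)) * qWellPoisedWeight ζ r * ζ ^ (5 * r) * C r ^ 5 * h_sign
    _ = _ := by
      linear_combination (qWellPoisedWeight ζ r * C r ^ 5) * (ζ ^ (m * (m + 1)) * ζ ^ (5 * r)) *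
        h_period

lemma qWellPoisedWeight_mul_add (l r : ℕ) : qWellPoisedWeight ζ ((2 * m + 1) * l + r) =
    (-1) ^ l * qWellPoisedWeight ζ r := by
  have h_sign : (-1 : K) ^ ((2 * m + 1) * l) = (-1) ^ l := by
    rw [pow_mul, pow_succ, pow_mul, neg_one_sq, one_pow, one_mul]
  have e₁ : ((2 * m + 1) * l + r) ^ 2 + ((2 * m + 1) * l + r) =
    (2 * m + 1) * (l * ((2 * m + 1) * l + 2 * r + 1)) + (r ^ 2 + r) := by ring
  have e₂ : 4 * ((2 * m + 1) * l + r) + 1 = (2 * m + 1) * (4 * l) + (4 * r + 1) := by ring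
  simp only [qWellPoisedWeight]
  rw [e₁, e₂, pow_add_mul_of_pow_eq_one hζ.pow_eq_one, qNat_mul_add hζ (by omega), pow_add,
    h_sign]
  ring

lemma IsQHalfRatio.shift {C : ℕ → K} (hC : IsQHalfRatio ζ C) (l : ℕ) :
    IsQHalfRatio ζ fun r ↦ C ((2 * m + 1) * l + r) := fun r ↦ by
  have h := hC ((2 * m + 1) * l + r)
  have e (i : ℕ) : 2 * ((2 * m + 1) * l + r) + i = (2 * m + 1) * (2 * l) + (2 * r + i) := by ring
  rwa [e, e, qNat_mul_add hζ (by omega), qNat_mul_add hζ (by omega)] at h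

variable [CharZero K]

lemma IsQHalfRatio.sum_block_eq_zero {C x : ℕ → K} (hC : IsQHalfRatio ζ C)
    (hx : ∀ r ≤ m, x (m - r) = x r) :
    ∑ r ∈ range (2 * m + 1), qWellPoisedWeight ζ r * C r ^ 5 * x r = 0 := by
  set f : ℕ → K := fun r ↦ qWellPoisedWeight ζ r * C r ^ 5 * x r with hf
  have h_upper : ∑ r ∈ range m, f (m + 1 + r) = 0 := sum_eq_zero fun i hi ↦ by
    have := mem_range.mp hi
    simp [hf, hC.eq_zero hζ (show m < m + 1 + i by omega) (by omega)]
  have h_anti : ∑ r ∈ range (m + 1), f (m - r) = -∑ r ∈ range (m + 1), f r := by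
    rw [← sum_neg_distrib]
    refine sum_congr rfl fun r hr ↦ ?_
    have hr' : r ≤ m := Nat.lt_succ_iff.mp (mem_range.mp hr)
    simp only [hf, hC.weight_mul_pow_five_reflect hζ hm hr', hx r hr', neg_mul]
  rw [show 2 * m + 1 = m + 1 + m by ring, sum_range_add, h_upper, add_zero]
  exact self_eq_neg.mp ((sum_range_reflect f (m + 1)).symm.trans h_anti)

lemma IsQHalfRatio.sum_eq_zero {C x : ℕ → K} (hC : IsQHalfRatio ζ C)
    (hx : IsBlockSymmetric m x) (L : ℕ) :
    ∑ k ∈ range ((2 * m + 1) * L), qWellPoisedWeight ζ k * C k ^ 5 * x k = 0 := by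
  induction L with
  | zero => simp
  | succ L ih =>
    have h_block := (hC.shift hζ hm L).sum_block_eq_zero
      (x := fun r ↦ x ((2 * m + 1) * L + r)) hζ hm (hx L)
    rw [mul_add_one, sum_range_add, ih, zero_add, ← mul_zero ((-1 : K) ^ L), ← h_block, mul_sum]
    refine sum_congr rfl fun r _ ↦ ?_
    rw [qWellPoisedWeight_mul_add hζ hm]
    ring

end RootsOfUnity

/-! ### Specializations of `ℤ[q]` localized at `(p, q - 1)` -/

section LocalRing

/-- The prime ideal `(p, q - 1)` of `ℤ[q]`. -/
noncomputable def qPrime (p : ℕ) : Ideal ℤ[X] := (Ideal.span {(p : ℤ)}).comap (evalRingHom 1)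

lemma mem_qPrime {p : ℕ} {f : ℤ[X]} : f ∈ qPrime p ↔ (p : ℤ) ∣ f.eval 1 := by
  rw [qPrime, Ideal.mem_comap, Ideal.mem_span_singleton, coe_evalRingHom]

lemma aeval_one_eq_intCast (f : ℤ[X]) : aeval (1 : ℚ) f = (f.eval 1 : ℤ) := by
  simpa using aeval_algebraMap_apply ℚ (1 : ℤ) f

lemma aeval_one_ne_zero {p : ℕ} {f : ℤ[X]} (hf : f ∉ qPrime p) : aeval (1 : ℚ) f ≠ 0 := by
  rw [aeval_one_eq_intCast, Int.cast_ne_zero]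
  exact fun h ↦ hf (mem_qPrime.mpr (h ▸ dvd_zero _))

variable {p : ℕ} [hp : Fact p.Prime]

instance : (qPrime p).IsPrime := by
  have hp' : Prime (p : ℤ) := Nat.prime_iff_prime_int.mp hp.out
  have := (Ideal.span_singleton_prime hp'.ne_zero).mpr hp'
  exact Ideal.comap_isPrime _ _

/-- The localization of `ℤ[q]` at `(p, q - 1)`, in which `q`-analogues of `p`-integral rational
numbers live. -/
abbrev QRing (p : ℕ) [Fact p.Prime] : Type := Localization.AtPrime (qPrime p)

instance : IsDomain (QRing p) :=
  IsLocalization.isDomain_localization (qPrime p).primeCompl_le_nonZeroDivisors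

/-- The variable `q`. -/
noncomputable def qVar (p : ℕ) [Fact p.Prime] : QRing p := algebraMap ℤ[X] _ X

/-- The cyclotomic polynomial of order `p ^ (i + 1)` in `q`. -/
noncomputable def qCyclotomic (p : ℕ) [Fact p.Prime] (i : ℕ) : QRing p :=
  algebraMap ℤ[X] _ (cyclotomic (p ^ (i + 1)) ℤ)

/-- The root of unity `exp (2πi / p ^ (i + 1))`. -/
noncomputable def primePowRoot (p i : ℕ) : ℂ :=
  Complex.exp (2 * Real.pi * Complex.I / (p ^ (i + 1) : ℕ))

/-- Specialization of `q` at a point where no element outside `(p, q - 1)` vanishes. -/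
noncomputable def specialization {K : Type*} [Field K] (x : K)
    (hx : ∀ v ∉ qPrime p, aeval x v ≠ 0) : QRing p →+* K :=
  IsLocalization.lift (M := (qPrime p).primeCompl) (g := (aeval x : ℤ[X] →ₐ[ℤ] K).toRingHom)
    fun v ↦ (hx v v.2).isUnit

lemma specialization_algebraMap {K : Type*} [Field K] (x : K) (hx : ∀ v ∉ qPrime p, aeval x v ≠ 0)
    (f : ℤ[X]) : specialization x hx (algebraMap ℤ[X] _ f) = aeval x f :=
  IsLocalization.lift_eq _ f

/-- Specialization at `q = 1`. -/
noncomputable def atOne (p : ℕ) [Fact p.Prime] : QRing p →+* ℚ :=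
  specialization 1 fun _ ↦ aeval_one_ne_zero

lemma atOne_algebraMap (f : ℤ[X]) : atOne p (algebraMap ℤ[X] _ f) = (f.eval 1 : ℤ) :=
  (specialization_algebraMap _ _ f).trans (aeval_one_eq_intCast f)

lemma primePowRoot_isPrimitiveRoot (i : ℕ) :
    IsPrimitiveRoot (primePowRoot p i) (p ^ (i + 1)) :=
  Complex.isPrimitiveRoot_exp _ (pow_pos hp.out.pos _).ne'

lemma aeval_primePowRoot_eq_zero_iff {i : ℕ} {f : ℤ[X]} :
    aeval (primePowRoot p i) f = 0 ↔ cyclotomic (p ^ (i + 1)) ℤ ∣ f := by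
  have hi : 0 < p ^ (i + 1) := pow_pos hp.out.pos _
  have hζ := primePowRoot_isPrimitiveRoot (p := p) i
  rw [cyclotomic_eq_minpoly hζ hi]
  exact minpoly.isIntegrallyClosed_dvd_iff (hζ.isIntegral hi) f

lemma aeval_primePowRoot_ne_zero {i : ℕ} {f : ℤ[X]} (hf : f ∉ qPrime p) :
    aeval (primePowRoot p i) f ≠ 0 := fun h ↦ hf <| mem_qPrime.mpr <| by
  have h_dvd := eval_dvd (x := 1) (aeval_primePowRoot_eq_zero_iff.mp h)
  rwa [eval_one_cyclotomic_prime_pow] at h_dvd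

/-- Specialization at `q = exp (2πi / p ^ (i + 1))`. -/
noncomputable def atRoot (p : ℕ) [Fact p.Prime] (i : ℕ) : QRing p →+* ℂ :=
  specialization (primePowRoot p i) fun _ ↦ aeval_primePowRoot_ne_zero

lemma atRoot_algebraMap (i : ℕ) (f : ℤ[X]) :
    atRoot p i (algebraMap ℤ[X] _ f) = aeval (primePowRoot p i) f :=
  specialization_algebraMap _ _ f

lemma atOne_qVar : atOne p (qVar p) = 1 := by simp [qVar, atOne_algebraMap]

lemma atRoot_qVar (i : ℕ) : atRoot p i (qVar p) = primePowRoot p i := by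
  simp [qVar, atRoot_algebraMap]

lemma atOne_qCyclotomic (i : ℕ) : atOne p (qCyclotomic p i) = p := by
  simp [qCyclotomic, atOne_algebraMap, eval_one_cyclotomic_prime_pow]

lemma atRoot_qCyclotomic_self (i : ℕ) : atRoot p i (qCyclotomic p i) = 0 :=
  (atRoot_algebraMap _ _).trans (aeval_primePowRoot_eq_zero_iff.mpr dvd_rfl)

lemma primePowRoot_pow_eq_one {i t : ℕ} (h : i < t) : primePowRoot p i ^ p ^ t = 1 :=
  ((primePowRoot_isPrimitiveRoot i).pow_eq_one_iff_dvd _).mpr (pow_dvd_pow p h)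

lemma atRoot_qCyclotomic_of_lt {i t : ℕ} (h : i < t) : atRoot p i (qCyclotomic p t) = p := by
  rw [qCyclotomic, atRoot_algebraMap, cyclotomic_prime_pow_eq_geom_sum hp.out]
  simp [primePowRoot_pow_eq_one h]

lemma atOne_qNat (n : ℕ) : atOne p (qNat (qVar p) n) = n := by
  rw [map_qNat, atOne_qVar, qNat_one_left]

lemma qNat_qVar_ne_zero {n : ℕ} (hn : n ≠ 0) : qNat (qVar p) n ≠ 0 := fun h ↦ hn <| by
  rw [← Nat.cast_eq_zero (R := ℚ), ← atOne_qNat (p := p), h, map_zero]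

lemma isUnit_algebraMap_iff {f : ℤ[X]} :
    IsUnit (algebraMap ℤ[X] (QRing p) f) ↔ ¬ (p : ℤ) ∣ f.eval 1 := by
  rw [IsLocalization.AtPrime.isUnit_to_map_iff (QRing p) (qPrime p), Ideal.mem_primeCompl_iff,
    mem_qPrime]

lemma isUnit_qNat_qVar_pow (a : ℕ) {b : ℕ} (hb : ¬ p ∣ b) : IsUnit (qNat (qVar p ^ a) b) := by
  rw [qVar, ← map_pow, ← map_qNat, isUnit_algebraMap_iff, ← coe_evalRingHom, map_qNat]
  simpa [qNat_one_left, Int.natCast_dvd_natCast] using hb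

lemma isUnit_one_sub_qCyclotomic_sq_mul (t : ℕ) (b : QRing p) :
    IsUnit (1 - qCyclotomic p t ^ 2 * b) := by
  refine IsLocalRing.isUnit_one_sub_self_of_mem_nonunits _ fun h ↦ ?_
  have h_dvd : qCyclotomic p t ∣ qCyclotomic p t ^ 2 * b := (dvd_pow_self _ two_ne_zero).mul_right b
  exact isUnit_algebraMap_iff.mp (isUnit_of_dvd_unit h_dvd h) (by
    rw [eval_one_cyclotomic_prime_pow])

lemma exists_isUnit_mul_eq_algebraMap (f : QRing p) : ∃ u v : ℤ[X],
    IsUnit (algebraMap ℤ[X] (QRing p) v) ∧ f * algebraMap ℤ[X] _ v = algebraMap ℤ[X] _ u := by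
  obtain ⟨⟨u, v⟩, h⟩ := IsLocalization.surj (qPrime p).primeCompl f
  exact ⟨u, v, IsLocalization.map_units _ v, h⟩

lemma isRelPrime_cyclotomic_prime_pow {i j : ℕ} (hij : i ≠ j) :
    IsRelPrime (cyclotomic (p ^ (i + 1)) ℤ) (cyclotomic (p ^ (j + 1)) ℤ) := by
  have h_irr (i : ℕ) := cyclotomic.irreducible (pow_pos hp.out.pos (i + 1))
  refine (h_irr i).isRelPrime_iff_not_dvd.mpr fun h_dvd ↦ hij ?_
  have h_eq := eq_of_monic_of_associated (cyclotomic.monic _ ℤ) (cyclotomic.monic _ ℤ)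
    ((h_irr i).associated_of_dvd (h_irr j) h_dvd)
  exact Nat.succ_injective (Nat.pow_right_injective hp.out.two_le (cyclotomic_injective h_eq))

lemma prod_qCyclotomic_dvd {I : Finset ℕ} {f : QRing p} (hf : ∀ i ∈ I, atRoot p i f = 0) :
    ∏ i ∈ I, qCyclotomic p i ∣ f := by
  obtain ⟨u, v, hv, h⟩ := exists_isUnit_mul_eq_algebraMap f
  have h_dvd : ∏ i ∈ I, cyclotomic (p ^ (i + 1)) ℤ ∣ u := by
    refine Finset.prod_dvd_of_isRelPrime
      (fun i _ j _ hij ↦ isRelPrime_cyclotomic_prime_pow hij) fun i hi ↦ ?_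
    rw [← aeval_primePowRoot_eq_zero_iff, ← atRoot_algebraMap, ← h, map_mul, hf i hi, zero_mul]
  rw [← hv.dvd_mul_right, h]
  simpa only [qCyclotomic, map_prod] using map_dvd (algebraMap ℤ[X] (QRing p)) h_dvd

lemma exists_atOne_eq_pow_mul {s : ℕ} {f : QRing p} (hf : ∀ i < s, atRoot p i f = 0) :
    ∃ g, atOne p f = (p : ℚ) ^ s * atOne p g := by
  obtain ⟨g, rfl⟩ := prod_qCyclotomic_dvd (I := range s) fun i hi ↦ hf i (mem_range.mp hi)
  exact ⟨g, by simp [map_prod, atOne_qCyclotomic]⟩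

lemma ratModEq_iff {e : ℕ} {a b : ℚ} :
    RatModEq p e a b ↔ ∃ f, a - b = (p : ℚ) ^ e * atOne p f := by
  constructor
  · rintro ⟨u, v, hv, h⟩
    have hv' : IsUnit (algebraMap ℤ[X] (QRing p) (C v)) :=
      isUnit_algebraMap_iff.mpr (by rwa [eval_C])
    obtain ⟨w, hw⟩ := hv'.exists_right_inv
    refine ⟨algebraMap ℤ[X] _ (C u) * w, h.trans ?_⟩
    have h_one := congrArg (atOne p) hw
    rw [map_mul, atOne_algebraMap, eval_C, map_one] at h_one
    rw [map_mul, atOne_algebraMap, eval_C, eq_inv_of_mul_eq_one_right h_one, div_eq_mul_inv]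
  · rintro ⟨f, h⟩
    obtain ⟨u, v, hv, huv⟩ := exists_isUnit_mul_eq_algebraMap f
    refine ⟨u.eval 1, v.eval 1, isUnit_algebraMap_iff.mp hv, h.trans ?_⟩
    have h_one := congrArg (atOne p) huv
    rw [map_mul, atOne_algebraMap, atOne_algebraMap] at h_one
    have hv₀ : ((v.eval 1 : ℤ) : ℚ) ≠ 0 := by
      rw [← atOne_algebraMap (p := p)]; exact (hv.map (atOne p)).ne_zero
    rw [← h_one, mul_div_cancel_right₀ _ hv₀]

lemma RatModEq.trans {e : ℕ} {a b c : ℚ} (hab : RatModEq p e a b) (hbc : RatModEq p e b c) :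
    RatModEq p e a c := by
  obtain ⟨f, hf⟩ := ratModEq_iff.mp hab
  obtain ⟨g, hg⟩ := ratModEq_iff.mp hbc
  exact ratModEq_iff.mpr ⟨f + g, by rw [map_add, mul_add, ← hf, ← hg, sub_add_sub_cancel]⟩

end LocalRing

section QHalfRatio

variable {p : ℕ} [hp : Fact p.Prime] (h_odd : Odd p)

/-- The `q`-analogue `(q; q²)_k / (q²; q²)_k` of `(1/2)_k / k!`; the defining equation is solvable
when `p` is odd. -/
noncomputable def qHalfRatio (p : ℕ) [Fact p.Prime] (k : ℕ) : QRing p :=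
  Classical.epsilon fun c ↦
    c * ∏ i ∈ range k, qNat (qVar p) (2 * i + 2) = ∏ i ∈ range k, qNat (qVar p) (2 * i + 1)

include h_odd

lemma prod_qNat_even_dvd_prod_qNat_odd (k : ℕ) :
    ∏ i ∈ range k, qNat (qVar p) (2 * i + 2) ∣ ∏ i ∈ range k, qNat (qVar p) (2 * i + 1) := by
  set U : QRing p := ∏ i ∈ range k, qNat (qVar p ^ (i + 1)) 2 with hU
  have h_unit : IsUnit U := IsUnit.prod_iff.mpr fun i _ ↦ isUnit_qNat_qVar_pow (i + 1) <|
    (Nat.prime_dvd_prime_iff_eq hp.out Nat.prime_two).not.mpr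
      (h_odd.ne_two_of_dvd_nat dvd_rfl)
  have h_even : ∏ i ∈ range k, qNat (qVar p) (2 * i + 2) = qFactorial (qVar p) k * U := by
    rw [qFactorial, hU, ← prod_mul_distrib]
    exact prod_congr rfl fun i _ ↦ by rw [← qNat_mul]; congr 1; ring
  have h_ne : qFactorial (qVar p) k ≠ 0 :=
    prod_ne_zero_iff.mpr fun i _ ↦ qNat_qVar_ne_zero i.succ_ne_zero
  have h_dvd := qFactorial_mul_qFactorial_dvd (qVar p) k k
  rw [← two_mul, qFactorial_two_mul, h_even, mul_assoc, mul_dvd_mul_iff_left h_ne,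
    h_unit.dvd_mul_left] at h_dvd
  rwa [h_even, h_unit.mul_right_dvd]

lemma qHalfRatio_mul_prod (k : ℕ) :
    qHalfRatio p k * ∏ i ∈ range k, qNat (qVar p) (2 * i + 2) =
      ∏ i ∈ range k, qNat (qVar p) (2 * i + 1) := by
  obtain ⟨c, hc⟩ := prod_qNat_even_dvd_prod_qNat_odd h_odd k
  exact Classical.epsilon_spec (p := fun c : QRing p ↦ c * _ = _) ⟨c, by rw [mul_comm, ← hc]⟩

lemma isQHalfRatio_qHalfRatio : IsQHalfRatio (qVar p) (qHalfRatio p) := fun k ↦ by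
  have h_ne : ∏ i ∈ range k, qNat (qVar p) (2 * i + 2) ≠ 0 :=
    prod_ne_zero_iff.mpr fun i _ ↦ qNat_qVar_ne_zero (by omega)
  have h_succ := qHalfRatio_mul_prod h_odd (k + 1)
  rw [prod_range_succ, prod_range_succ, ← qHalfRatio_mul_prod h_odd k] at h_succ
  refine mul_left_cancel₀ h_ne ?_
  linear_combination h_succ

lemma atOne_qHalfRatio (k : ℕ) : atOne p (qHalfRatio p k) = halfRatio ℚ k := by
  have h_zero : qHalfRatio p 0 = 1 := by simpa using qHalfRatio_mul_prod h_odd 0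
  refine IsQHalfRatio.eq_halfRatio (C := fun k ↦ atOne p (qHalfRatio p k)) ?_ ?_ k
  · simpa only [atOne_qVar] using (isQHalfRatio_qHalfRatio h_odd).map (atOne p)
  · rw [h_zero, map_one]

lemma isQHalfRatio_atRoot (i : ℕ) :
    IsQHalfRatio (primePowRoot p i) fun k ↦ atRoot p i (qHalfRatio p k) := by
  simpa only [atRoot_qVar] using (isQHalfRatio_qHalfRatio h_odd).map (atRoot p i)

end QHalfRatio

section BlockSymmetric

/-- The integer part of `p ^ s / 2` for odd `p`. -/
def halfPow (p s : ℕ) : ℕ := (p ^ s - 1) / 2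

lemma two_mul_halfPow_add_one {p : ℕ} (hp : Odd p) (s : ℕ) : 2 * halfPow p s + 1 = p ^ s := by
  obtain ⟨c, hc⟩ := hp.pow (n := s)
  rw [halfPow]
  omega

lemma halfPow_add_half {K : Type*} [Field K] [CharZero K] {p : ℕ} (hp : Odd p) (s : ℕ) :
    (halfPow p s : K) + 1 / 2 = p ^ s / 2 := by
  rw [← Nat.cast_pow, ← two_mul_halfPow_add_one hp s]
  push_cast
  ring

lemma halfPow_eq_add {p : ℕ} (hp : Odd p) {i s : ℕ} (hi : i ≤ s) :
    halfPow p s = (2 * halfPow p i + 1) * halfPow p (s - i) + halfPow p i := by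
  have h_pow : p ^ s = p ^ i * p ^ (s - i) := by rw [← pow_add, Nat.add_sub_cancel' hi]
  simp only [← two_mul_halfPow_add_one hp] at h_pow
  linarith

lemma mul_add_le_mul_add_iff {d m r : ℕ} (hr : r ≤ m) (hm : m < d) (l c : ℕ) :
    d * l + r ≤ d * c + m ↔ l ≤ c := by
  refine ⟨fun h ↦ Nat.lt_succ_iff.mp <| lt_of_mul_lt_mul_left ?_ d.zero_le,
    fun h ↦ add_le_add (Nat.mul_le_mul_left d h) hr⟩
  rw [Nat.mul_succ]
  omega

lemma IsBlockSymmetric.ite {K : Type*} {m : ℕ} {x y : ℕ → K} (hx : IsBlockSymmetric m x)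
    (hy : IsBlockSymmetric m y) (c : ℕ) :
    IsBlockSymmetric m fun k ↦ if k ≤ (2 * m + 1) * c + m then x k else y k := fun l r hr ↦ by
  simp only [mul_add_le_mul_add_iff hr (show m < 2 * m + 1 by omega),
    mul_add_le_mul_add_iff (Nat.sub_le m r) (show m < 2 * m + 1 by omega), hx l r hr, hy l r hr]

lemma IsBlockSymmetric.ite_halfPow {K : Type*} {p : ℕ} (hp : Odd p) {i s : ℕ} (hi : i ≤ s)
    {x y : ℕ → K} (hx : IsBlockSymmetric (halfPow p i) x) (hy : IsBlockSymmetric (halfPow p i) y) :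
    IsBlockSymmetric (halfPow p i) fun k ↦ if k ≤ halfPow p s then x k else y k := by
  rw [halfPow_eq_add hp hi]
  exact hx.ite hy _

lemma IsBlockSymmetric.of_antisymmetric_increments {K : Type*} [Field K] [CharZero K] {m : ℕ}
    {x c : ℕ → K}
    (h_succ : ∀ l, ∀ r < m, x ((2 * m + 1) * l + (r + 1)) =
      x ((2 * m + 1) * l + r) + c ((2 * m + 1) * l + r))
    (h_anti : ∀ l, ∀ r < m, c ((2 * m + 1) * l + (m - 1 - r)) = -c ((2 * m + 1) * l + r)) :
    IsBlockSymmetric m x := fun l ↦ by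
  have h_succ' := h_succ l
  have h_anti' := h_anti l
  generalize (2 * m + 1) * l = b at h_succ' h_anti' ⊢
  have h_reflect : ∀ r ≤ m, x (b + (m - r)) - x (b + m) = x (b + r) - x b := fun r ↦ by
    induction r with
    | zero => simp
    | succ r ih =>
      intro hr
      have h_left := h_succ' (m - 1 - r) (by omega)
      rw [h_anti' r (by omega), show m - 1 - r + 1 = m - r by omega,
        show m - 1 - r = m - (r + 1) by omega] at h_left
      linear_combination ih (by omega) - h_left - h_succ' r (by omega)
  have h_end : x (b + m) = x b := by
    have h := h_reflect m le_rfl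
    rw [Nat.sub_self, add_zero] at h
    linear_combination -h / 2
  intro r hr
  linear_combination h_reflect r hr + h_end

end BlockSymmetric

section QSums

variable {p : ℕ} [hp : Fact p.Prime]

lemma exists_sum_eq_pow_mul (h_odd : Odd p) {s : ℕ} {T : ℕ → QRing p}
    (hT : ∀ i < s, ∃ x, IsBlockSymmetric (halfPow p (i + 1)) x ∧
      ∀ k < p ^ s, atRoot p i (T k) = atRoot p i (qHalfRatio p k) ^ 5 * x k) :
    ∃ g, ∑ k ∈ range (p ^ s), (-1 : ℚ) ^ k * (4 * k + 1) * atOne p (T k) =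
      (p : ℚ) ^ s * atOne p g := by
  have h_atOne : atOne p (∑ k ∈ range (p ^ s), qWellPoisedWeight (qVar p) k * T k) =
      ∑ k ∈ range (p ^ s), (-1 : ℚ) ^ k * (4 * k + 1) * atOne p (T k) := by
    simp only [map_sum, map_mul, map_qWellPoisedWeight, atOne_qVar, qWellPoisedWeight_one_left]
  rw [← h_atOne]
  refine exists_atOne_eq_pow_mul fun i hi ↦ ?_
  obtain ⟨x, hx, hTx⟩ := hT i hi
  have h_block := two_mul_halfPow_add_one h_odd (i + 1)
  have h_pos : 0 < halfPow p (i + 1) := by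
    have : 1 < p ^ (i + 1) := Nat.one_lt_pow i.succ_ne_zero hp.out.one_lt
    omega
  have h_vanish := (isQHalfRatio_atRoot h_odd i).sum_eq_zero
    (h_block.symm ▸ primePowRoot_isPrimitiveRoot i) h_pos hx (p ^ (s - (i + 1)))
  rw [h_block, ← pow_add, Nat.add_sub_cancel' hi] at h_vanish
  rw [map_sum, ← h_vanish]
  refine sum_congr rfl fun k hk ↦ ?_
  rw [map_mul, map_qWellPoisedWeight, atRoot_qVar, hTx k (mem_range.mp hk), mul_assoc]

lemma qNat_dvd_qNat_pow {t m : ℕ} (hm : ¬ p ^ (t + 1) ∣ m) :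
    qNat (qVar p) m ∣ qNat (qVar p) (p ^ t) := by
  obtain ⟨e, b, hb, rfl⟩ := Nat.exists_eq_pow_mul_and_not_dvd
    (show m ≠ 0 by rintro rfl; exact hm (dvd_zero _)) p hp.out.ne_one
  have he : e ≤ t := Nat.lt_succ_iff.mp <| lt_of_not_ge fun h ↦
    hm ((pow_dvd_pow p h).mul_right b)
  rw [qNat_mul, (isUnit_qNat_qVar_pow (p ^ e) hb).mul_right_dvd, ← Nat.add_sub_cancel' he, pow_add,
    qNat_mul]
  exact dvd_mul_right _ _

/-- The `q`-analogue `[p ^ t] / [m]` of `p ^ t / m`, for `m` not divisible by `p ^ (t + 1)`. -/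
noncomputable def qQuotient (p : ℕ) [Fact p.Prime] (t m : ℕ) : QRing p :=
  Classical.epsilon fun a ↦ qNat (qVar p) m * a = qNat (qVar p) (p ^ t)

/-- The `q`-analogue `q ^ m [p ^ t] ^ 2 / [m] ^ 2` of `(p ^ t / m) ^ 2`; the factor `q ^ m` makes
it invariant under `m ↦ -m` at roots of unity. -/
noncomputable def qQuotientSq (p : ℕ) [Fact p.Prime] (t m : ℕ) : QRing p :=
  qVar p ^ m * qQuotient p t m ^ 2

lemma qNat_mul_qQuotient {t m : ℕ} (hm : ¬ p ^ (t + 1) ∣ m) :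
    qNat (qVar p) m * qQuotient p t m = qNat (qVar p) (p ^ t) := by
  obtain ⟨a, ha⟩ := qNat_dvd_qNat_pow hm
  exact Classical.epsilon_spec (p := fun a : QRing p ↦ _ * a = _) ⟨a, ha.symm⟩

lemma atOne_qQuotientSq {t m : ℕ} (hm : ¬ p ^ (t + 1) ∣ m) :
    atOne p (qQuotientSq p t m) = ((p : ℚ) ^ t / m) ^ 2 := by
  have h := congrArg (atOne p) (qNat_mul_qQuotient hm)
  rw [map_mul, atOne_qNat, atOne_qNat, Nat.cast_pow] at h
  have hm₀ : (m : ℚ) ≠ 0 := Nat.cast_ne_zero.mpr (by rintro rfl; exact hm (dvd_zero _))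
  rw [qQuotientSq, map_mul, map_pow, map_pow, atOne_qVar, one_pow, one_mul, ← h,
    mul_div_cancel_left₀ _ hm₀]

lemma atRoot_qQuotientSq {i t m : ℕ} (hm : ¬ p ^ (t + 1) ∣ m) :
    qNat (primePowRoot p i) m ^ 2 * atRoot p i (qQuotientSq p t m) =
      primePowRoot p i ^ m * qNat (primePowRoot p i) (p ^ t) ^ 2 := by
  have h := congrArg (atRoot p i) (qNat_mul_qQuotient hm)
  rw [map_mul, map_qNat, map_qNat, atRoot_qVar] at h
  rw [qQuotientSq, map_mul, map_pow, map_pow, atRoot_qVar, ← h]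
  ring

lemma qNat_primePowRoot_ne_zero {i m : ℕ} (hm : ¬ p ^ (i + 1) ∣ m) :
    qNat (primePowRoot p i) m ≠ 0 :=
  qNat_ne_zero_of_not_dvd (primePowRoot_isPrimitiveRoot i) hm

lemma atRoot_qQuotientSq_eq_zero {i t m : ℕ} (hi : i < t) (hm : ¬ p ^ (i + 1) ∣ m) :
    atRoot p i (qQuotientSq p t m) = 0 := by
  have hζ := primePowRoot_isPrimitiveRoot (p := p) i
  have h_pow : qNat (primePowRoot p i) (p ^ t) = 0 := by
    rw [← Nat.add_sub_cancel' (Nat.succ_le_of_lt hi), pow_add]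
    exact qNat_mul_eq_zero hζ (Nat.one_lt_pow i.succ_ne_zero hp.out.one_lt) _
  have h := atRoot_qQuotientSq (i := i) (t := t) fun h ↦ hm ((pow_dvd_pow p (by omega)).trans h)
  rw [h_pow, zero_pow two_ne_zero, mul_zero] at h
  exact (mul_eq_zero.mp h).resolve_left (pow_ne_zero 2 (qNat_primePowRoot_ne_zero hm))

lemma atRoot_qQuotientSq_eq {i t a b : ℕ} (hi : i ≤ t) (ha : ¬ p ^ (i + 1) ∣ a)
    (hab : p ^ (i + 1) ∣ a + b) :
    atRoot p i (qQuotientSq p t a) = atRoot p i (qQuotientSq p t b) := by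
  have hζ := primePowRoot_isPrimitiveRoot (p := p) i
  have h_not_dvd {m : ℕ} (hm : ¬ p ^ (i + 1) ∣ m) : ¬ p ^ (t + 1) ∣ m := fun h ↦
    hm ((pow_dvd_pow p (by omega)).trans h)
  have hb : ¬ p ^ (i + 1) ∣ b := fun h ↦ ha ((Nat.dvd_add_left h).mp hab)
  have h_neg := qNat_mul_pow_eq_neg hζ (Nat.one_lt_pow i.succ_ne_zero hp.out.one_lt) hab
  have h_one : primePowRoot p i ^ a * primePowRoot p i ^ b = 1 := by
    rw [← pow_add]; exact (hζ.pow_eq_one_iff_dvd _).mpr hab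
  have h_a := atRoot_qQuotientSq (i := i) (h_not_dvd ha)
  have h_b := atRoot_qQuotientSq (i := i) (h_not_dvd hb)
  refine mul_left_cancel₀ (pow_ne_zero 2 (qNat_primePowRoot_ne_zero hb)) ?_
  generalize qNat (primePowRoot p i) a = A at *
  rw [← neg_eq_iff_eq_neg.mpr h_neg] at h_b ⊢
  linear_combination primePowRoot p i ^ (2 * b) * h_a - h_b +
    primePowRoot p i ^ b * qNat (primePowRoot p i) (p ^ t) ^ 2 * h_one

end QSums

section Deviation

variable {R : Type*} [CommRing R]

/-- The element `δ_k` with `∏ i < k, (1 - ε a_i) / (1 - ε b_i) = 1 - ε δ_k`, defined whenever the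
denominators are units. -/
noncomputable def deviation (ε : R) (a b : ℕ → R) : ℕ → R
  | 0 => 0
  | k + 1 => (deviation ε a b k * (1 - ε * a k) + (a k - b k)) * Ring.inverse (1 - ε * b k)

variable {ε : R} {a b : ℕ → R}

lemma deviation_succ_mul {k : ℕ} (hb : IsUnit (1 - ε * b k)) :
    deviation ε a b (k + 1) * (1 - ε * b k) =
      deviation ε a b k * (1 - ε * a k) + (a k - b k) := by
  rw [deviation, mul_assoc, Ring.inverse_mul_cancel _ hb, mul_one]

lemma prod_one_sub_eq_mul_prod (hb : ∀ k, IsUnit (1 - ε * b k)) (k : ℕ) :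
    ∏ i ∈ range k, (1 - ε * a i) =
      (1 - ε * deviation ε a b k) * ∏ i ∈ range k, (1 - ε * b i) := by
  induction k with
  | zero => simp [deviation]
  | succ k ih =>
    rw [prod_range_succ, prod_range_succ, ih]
    linear_combination ε * (∏ i ∈ range k, (1 - ε * b i)) * deviation_succ_mul (a := a) (hb k)

lemma dvd_deviation_sub_sum (hb : ∀ k, IsUnit (1 - ε * b k)) (k : ℕ) :
    ε ∣ deviation ε a b k - ∑ i ∈ range k, (a i - b i) := by
  induction k with
  | zero => simp [deviation]
  | succ k ih =>
    obtain ⟨c, hc⟩ := ih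
    refine ⟨c + b k * deviation ε a b (k + 1) - a k * deviation ε a b k, ?_⟩
    rw [sum_range_succ]
    linear_combination hc + deviation_succ_mul (a := a) (hb k)

lemma map_deviation_succ {S : Type*} [CommRing S] (φ : R →+* S) {k : ℕ}
    (hb : IsUnit (1 - ε * b k)) (h_a : φ ε * φ (a k) = 0) (h_b : φ ε * φ (b k) = 0) :
    φ (deviation ε a b (k + 1)) = φ (deviation ε a b k) + (φ (a k) - φ (b k)) := by
  have h := congrArg φ (deviation_succ_mul (a := a) hb)
  simpa only [map_mul, map_sub, map_add, map_one, h_a, h_b, sub_zero, mul_one] using h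

end Deviation

section HalfDeviation

variable {p : ℕ} [hp : Fact p.Prime] {c t : ℕ}

/-- The element `δ_k` with `1 - p ^ 2 δ_k = pairRatio z k / halfRatio k ^ 2` at `q = 1`, where
`z = (p ^ (t + 1) / (2 * c)) ^ 2`. -/
noncomputable def halfDeviation (p : ℕ) [Fact p.Prime] (t c : ℕ) : ℕ → QRing p :=
  deviation (qCyclotomic p t ^ 2) (fun i ↦ qQuotientSq p t (c * (2 * i + 1)))
    fun i ↦ qQuotientSq p t (c * (2 * i + 2))

lemma sq_sub_sq_eq_mul_atOne {j : ℕ} (h : ¬ p ^ (t + 1) ∣ c * (j + 1)) :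
    ((j + 1 : ℚ) / 2) ^ 2 - (p ^ (t + 1) / (2 * c)) ^ 2 =
      ((j + 1) / 2) ^ 2 * atOne p (1 - qCyclotomic p t ^ 2 * qQuotientSq p t (c * (j + 1))) := by
  have hc : (c : ℚ) ≠ 0 := Nat.cast_ne_zero.mpr fun hc ↦ h (by simp [hc])
  have hj : (j + 1 : ℚ) ≠ 0 := j.cast_add_one_ne_zero
  rw [map_sub, map_one, map_mul, map_pow, atOne_qCyclotomic, atOne_qQuotientSq h]
  push_cast
  field_simp
  ring

lemma pairRatio_eq_mul_one_sub {k : ℕ} (h : ∀ j < 2 * k, ¬ p ^ (t + 1) ∣ c * (j + 1)) :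
    pairRatio (((p : ℚ) ^ (t + 1) / (2 * c)) ^ 2) k =
      halfRatio ℚ k ^ 2 * (1 - p ^ 2 * atOne p (halfDeviation p t c k)) := by
  have h_unit (i : ℕ) := isUnit_one_sub_qCyclotomic_sq_mul t (qQuotientSq p t (c * (2 * i + 2)))
  have h_prod := congrArg (atOne p) (prod_one_sub_eq_mul_prod
    (a := fun i ↦ qQuotientSq p t (c * (2 * i + 1))) h_unit k)
  have h_den : ∏ i ∈ range k,
      atOne p (1 - qCyclotomic p t ^ 2 * qQuotientSq p t (c * (2 * i + 2))) ≠ 0 :=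
    prod_ne_zero_iff.mpr fun i _ ↦ ((h_unit i).map (atOne p)).ne_zero
  rw [map_prod, map_mul, map_prod, ← div_eq_iff h_den, ← prod_div_distrib] at h_prod
  have h_dev : 1 - (p : ℚ) ^ 2 * atOne p (halfDeviation p t c k) =
    atOne p (1 - qCyclotomic p t ^ 2 * halfDeviation p t c k) := by simp [atOne_qCyclotomic]
  rw [h_dev, halfDeviation, ← h_prod, pairRatio, halfRatio, ← prod_pow, ← prod_mul_distrib]
  refine prod_congr rfl fun i hi ↦ ?_
  have hi' := mem_range.mp hi
  have h_num := sq_sub_sq_eq_mul_atOne (h (2 * i) (by omega))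
  have h_denom := sq_sub_sq_eq_mul_atOne (h (2 * i + 1) (by omega))
  push_cast at h_num h_denom
  rw [show (i : ℚ) + 1 / 2 = (2 * i + 1) / 2 by ring, h_num,
    show (i : ℚ) + 1 = (2 * i + 1 + 1) / 2 by ring, h_denom, mul_div_mul_comm, ← div_pow]

lemma qCyclotomic_sq_dvd_halfDeviation_sub (k : ℕ) :
    qCyclotomic p t ^ 2 ∣ halfDeviation p t c k -
      ∑ i ∈ range k, (qQuotientSq p t (c * (2 * i + 1)) - qQuotientSq p t (c * (2 * i + 2))) :=
  dvd_deviation_sub_sum (fun _ ↦ isUnit_one_sub_qCyclotomic_sq_mul t _) k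

lemma atRoot_qCyclotomic_sq_mul_qQuotientSq {i m : ℕ} (hi : i ≤ t) (hm : ¬ p ^ (i + 1) ∣ m) :
    atRoot p i (qCyclotomic p t ^ 2) * atRoot p i (qQuotientSq p t m) = 0 := by
  rcases hi.lt_or_eq with hi | rfl
  · rw [atRoot_qQuotientSq_eq_zero hi hm, mul_zero]
  · rw [map_pow, atRoot_qCyclotomic_self, zero_pow two_ne_zero, zero_mul]

lemma atRoot_halfDeviation_succ {i k : ℕ} (hi : i ≤ t)
    (h : ∀ j < 2, ¬ p ^ (i + 1) ∣ c * (2 * k + (j + 1))) :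
    atRoot p i (halfDeviation p t c (k + 1)) = atRoot p i (halfDeviation p t c k) +
      (atRoot p i (qQuotientSq p t (c * (2 * k + 1))) -
        atRoot p i (qQuotientSq p t (c * (2 * k + 2)))) :=
  map_deviation_succ (atRoot p i) (isUnit_one_sub_qCyclotomic_sq_mul t _)
    (atRoot_qCyclotomic_sq_mul_qQuotientSq hi (h 0 two_pos))
    (atRoot_qCyclotomic_sq_mul_qQuotientSq hi (h 1 one_lt_two))

lemma isBlockSymmetric_atRoot_halfDeviation (h_odd : Odd p) {i : ℕ} (hi : i ≤ t) :
    IsBlockSymmetric (halfPow p (i + 1)) fun k ↦ atRoot p i (halfDeviation p t 1 k) := by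
  set m := halfPow p (i + 1)
  have hm : 2 * m + 1 = p ^ (i + 1) := two_mul_halfPow_add_one h_odd (i + 1)
  have h_not_dvd (l : ℕ) {r j : ℕ} (h_pos : 0 < 2 * r + j) (h_le : 2 * r + j ≤ 2 * m) :
      ¬ p ^ (i + 1) ∣ 1 * (2 * ((2 * m + 1) * l + r) + j) := by
    rw [← hm, one_mul, mul_add, add_assoc, Nat.dvd_add_right ((dvd_mul_right _ _).mul_left 2)]
    exact Nat.not_dvd_of_pos_of_lt h_pos (by omega)
  have h_symm (l : ℕ) {r j r' j' : ℕ} (h_pos : 0 < 2 * r + j) (h_le : 2 * r + j ≤ 2 * m)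
      (h_add : 2 * r + j + (2 * r' + j') = 2 * m + 1) :
      atRoot p i (qQuotientSq p t (1 * (2 * ((2 * m + 1) * l + r) + j))) =
        atRoot p i (qQuotientSq p t (1 * (2 * ((2 * m + 1) * l + r') + j'))) :=
    atRoot_qQuotientSq_eq hi (h_not_dvd l h_pos h_le) ⟨4 * l + 1, by rw [← hm]; linarith⟩
  refine .of_antisymmetric_increments (c := fun k ↦ atRoot p i (qQuotientSq p t (1 * (2 * k + 1))) -
      atRoot p i (qQuotientSq p t (1 * (2 * k + 2))))
    (fun l r hr ↦ atRoot_halfDeviation_succ hi fun j hj ↦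
      h_not_dvd l (r := r) (j := j + 1) (by omega) (by omega)) fun l r hr ↦ ?_
  rw [h_symm l (r := m - 1 - r) (j := 1) (r' := r) (j' := 2) (by omega) (by omega) (by omega),
    h_symm l (r := m - 1 - r) (j := 2) (r' := r) (j' := 1) (by omega) (by omega) (by omega),
    neg_sub]

end HalfDeviation

/-! ### Congruences for the partial sums -/

section WhippleValues

variable {K : Type*} [Field K] [CharZero K]

lemma add_one_sq_ne_add_half_sq (M i : ℕ) : ((i : K) + 1) ^ 2 ≠ ((M : K) + 1 / 2) ^ 2 := fun h ↦ by
  rcases sq_eq_sq_iff_eq_or_eq_neg.mp h with h | h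
  · exact natCast_add_half_ne_intCast M (i + 1) (by push_cast; exact h.symm)
  · exact natCast_add_half_ne_intCast M (-(i + 1)) (by push_cast; linear_combination h)

lemma wellPoisedSum_even_zero (N : ℕ) :
    wellPoisedSum (2 * N) (0 : K) = (4 * N + 1) * halfRatio K N ^ 2 := by
  rw [wellPoisedSum_even fun i ↦ pow_ne_zero 2 i.cast_add_one_ne_zero, zero_div,
    pairRatio_zero_left]

lemma wellPoisedSum_odd_zero (N : ℕ) : wellPoisedSum (2 * N + 1) (0 : K) = 0 := by
  rw [wellPoisedSum_odd fun i ↦ pow_ne_zero 2 i.cast_add_one_ne_zero, zero_div, mul_zero, zero_mul]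

lemma prod_four_mul_add_three_div_four_mul_add_one (n : ℕ) :
    ∏ i ∈ range n, (4 * (i : K) + 3) / (4 * i + 1) =
      (4 * n + 1) * ∏ i ∈ range n, (4 * (i : K) + 3) / (4 * i + 5) := by
  induction n with
  | zero => simp
  | succ n ih =>
    have h₁ : 4 * (n : K) + 1 ≠ 0 := by exact_mod_cast (4 * n).succ_ne_zero
    have h₅ : 4 * (n : K) + 5 ≠ 0 := by exact_mod_cast (4 * n + 4).succ_ne_zero
    rw [prod_range_succ, prod_range_succ, ih]
    push_cast
    field_simp
    ring

lemma prod_odd_half_factors (N : ℕ) :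
    ∏ i ∈ range N, ((2 * (i : K) + 2) ^ 2 - (((2 * N + 1 : ℕ) : K) + 1 / 2) ^ 2) /
        ((2 * i + 3) ^ 2 - (((2 * N + 1 : ℕ) : K) + 1 / 2) ^ 2) =
      (4 * N + 1) * (∏ j ∈ range N, (4 * (j : K) + 3) / (4 * j + 5)) *
        ∏ i ∈ range N, (4 * ((N + 1 + i : ℕ) : K) + 3) / (4 * ((N + 1 + i : ℕ) : K) + 5) := by
  rw [← prod_four_mul_add_three_div_four_mul_add_one,
    ← prod_range_reflect (fun j : ℕ ↦ (4 * (j : K) + 3) / (4 * j + 1)), ← prod_mul_distrib]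
  refine prod_congr rfl fun i hi ↦ ?_
  obtain ⟨j, rfl⟩ := Nat.exists_eq_add_of_lt (mem_range.mp hi)
  rw [show i + j + 1 - 1 - i = j by omega, div_mul_div_comm,
    ← mul_div_mul_right (_ - _) _ (show (-4 : K) ≠ 0 by norm_num)]
  congr 1 <;> push_cast <;> ring

lemma wellPoisedSum_odd_half (N : ℕ) :
    wellPoisedSum (2 * N + 1) ((((2 * N + 1 : ℕ) : K) + 1 / 2) ^ 2) =
      -(4 * N + 3) ^ 2 * ∏ j ∈ range (2 * N + 1), (4 * (j : K) + 3) / (4 * j + 5) := by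
  have h₁ : 4 * (N : K) + 1 ≠ 0 := by exact_mod_cast (4 * N).succ_ne_zero
  have h₅ : 4 * (N : K) + 5 ≠ 0 := by exact_mod_cast (4 * N + 4).succ_ne_zero
  have h_factor : (((2 * N + 1 : ℕ) : K) + 1 / 2) ^ 2 / (1 - (((2 * N + 1 : ℕ) : K) + 1 / 2) ^ 2) =
      -(4 * N + 3) ^ 2 / ((4 * N + 1) * (4 * N + 5)) := by
    rw [← mul_div_mul_right (_ ^ 2) _ (show (-4 : K) ≠ 0 by norm_num)]
    congr 1 <;> push_cast <;> ring
  rw [wellPoisedSum_odd (add_one_sq_ne_add_half_sq _), h_factor, prod_odd_half_factors,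
    show 2 * N + 1 = N + 1 + N by ring, prod_range_add _ (N + 1), prod_range_succ]
  field_simp

end WhippleValues

section RationalSums

lemma shiftedFactorial_eq_prod (x : ℚ) (k : ℕ) :
    shiftedFactorial x k = ∏ i ∈ range k, (x + i) := by
  induction k with
  | zero => simp [shiftedFactorial]
  | succ k ih =>
    rw [prod_range_succ, ← ih, shiftedFactorial, ascPochhammer_succ_eval, shiftedFactorial]

lemma shiftedFactorial_one (k : ℕ) : shiftedFactorial 1 k = k.factorial := by
  rw [shiftedFactorial, ascPochhammer_eval_one]

lemma shiftedFactorial_half_div_one (k : ℕ) :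
    shiftedFactorial (1 / 2) k / shiftedFactorial 1 k = halfRatio ℚ k := by
  simp only [shiftedFactorial_eq_prod, halfRatio, prod_div_distrib, add_comm]

lemma shiftedFactorial_three_quarters_div (k : ℕ) :
    shiftedFactorial (3 / 4) k / shiftedFactorial (5 / 4) k =
      ∏ j ∈ range k, (4 * (j : ℚ) + 3) / (4 * j + 5) := by
  rw [shiftedFactorial_eq_prod, shiftedFactorial_eq_prod, ← prod_div_distrib]
  refine prod_congr rfl fun j _ ↦ ?_
  rw [← mul_div_mul_left (_ + _) (_ + _) (four_ne_zero (α := ℚ))]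
  congr 1 <;> ring

lemma ramanujanPartialSum_eq_sum_halfRatio (m : ℕ) : ramanujanPartialSum m =
    ∑ k ∈ range (m + 1), (-1) ^ k * (4 * k + 1) * halfRatio ℚ k ^ 5 := by
  refine sum_congr rfl fun k _ ↦ ?_
  rw [← div_pow, ← shiftedFactorial_one, shiftedFactorial_half_div_one]

lemma ramanujanPartialSum_eq_interpolation (M : ℕ) :
    ramanujanPartialSum M = 2 * wellPoisedSum M 0 - wellPoisedSum M (((M : ℚ) + 1 / 2) ^ 2) +
      ∑ k ∈ range (M + 1), (-1) ^ k * (4 * k + 1) *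
        (halfRatio ℚ k * (halfRatio ℚ k ^ 2 - pairRatio (((M : ℚ) + 1 / 2) ^ 2) k) ^ 2) := by
  rw [ramanujanPartialSum_eq_sum_halfRatio, wellPoisedSum, wellPoisedSum, mul_sum,
    ← sum_sub_distrib, ← sum_add_distrib]
  refine sum_congr rfl fun k _ ↦ ?_
  rw [wellPoisedTerm, wellPoisedTerm, pairRatio_zero_left]
  ring

lemma harmonicOrder_succ (l m : ℕ) :
    harmonicOrder l (m + 1) = harmonicOrder l m + 1 / ((m + 1 : ℕ) : ℚ) ^ l :=
  sum_Icc_succ_top (by omega) _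

lemma harmonicOrder_two_mul (N : ℕ) : harmonicOrder 2 (2 * N) / 4 - harmonicOrder 2 N / 8 =
    ∑ i ∈ range N, ((1 / ((2 * (2 * i + 1) : ℕ) : ℚ)) ^ 2 -
      (1 / ((2 * (2 * i + 2) : ℕ) : ℚ)) ^ 2) := by
  induction N with
  | zero => simp [harmonicOrder]
  | succ N ih =>
    rw [sum_range_succ, ← ih, mul_add_one, harmonicOrder_succ, harmonicOrder_succ,
      harmonicOrder_succ]
    push_cast
    field_simp
    ring

end RationalSums

section Congruences

variable {p : ℕ} [hp : Fact p.Prime] {t : ℕ}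

lemma qCyclotomic_dvd_qHalfRatio (h_odd : Odd p) {k : ℕ} (hk : halfPow p (t + 1) < k)
    (hk' : k < p ^ (t + 1)) : qCyclotomic p t ∣ qHalfRatio p k := by
  have h_block := two_mul_halfPow_add_one h_odd (t + 1)
  have h_zero : atRoot p t (qHalfRatio p k) = 0 := (isQHalfRatio_atRoot h_odd t).eq_zero
    (h_block.symm ▸ primePowRoot_isPrimitiveRoot t) hk (by omega)
  simpa only [prod_singleton] using
    prod_qCyclotomic_dvd (I := {t}) fun i hi ↦ (mem_singleton.mp hi).symm ▸ h_zero

lemma atRoot_qCyclotomic_mul_mul_pow {i : ℕ} (hi : i ≤ t) (n : ℕ) (c : QRing p) :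
    atRoot p i (qCyclotomic p t * c * c ^ n) =
      atRoot p i (qCyclotomic p t * c) ^ (n + 1) * ((p : ℂ) ^ n)⁻¹ := by
  have hp₀ : (p : ℂ) ≠ 0 := Nat.cast_ne_zero.mpr hp.out.ne_zero
  rcases hi.lt_or_eq with hi | rfl
  · rw [map_mul, map_mul, map_pow, atRoot_qCyclotomic_of_lt hi, mul_pow,
      pow_succ, pow_succ]
    field_simp
  · simp [atRoot_qCyclotomic_self]

lemma exists_sum_tail_eq_pow_mul (h_odd : Odd p) (t : ℕ) : ∃ g,
    ∑ k ∈ range (p ^ (t + 1)), (-1 : ℚ) ^ k * (4 * k + 1) *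
      (if k ≤ halfPow p (t + 1) then 0 else halfRatio ℚ k ^ 5) =
        (p : ℚ) ^ (t + 1 + 4) * atOne p g := by
  choose! c hc using fun k (hk : halfPow p (t + 1) < k ∧ k < p ^ (t + 1)) ↦
    qCyclotomic_dvd_qHalfRatio h_odd hk.1 hk.2
  set T : ℕ → QRing p := fun k ↦
    if k ≤ halfPow p (t + 1) then 0 else qHalfRatio p k * c k ^ 4 with hT
  have h_root (i) (hi : i < t + 1) (k) (hk : k < p ^ (t + 1)) : atRoot p i (T k) =
      atRoot p i (qHalfRatio p k) ^ 5 * if k ≤ halfPow p (t + 1) then 0 else ((p : ℂ) ^ 4)⁻¹ := by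
    simp only [hT]
    split_ifs with h
    · rw [map_zero, mul_zero]
    · rw [hc k ⟨not_le.mp h, hk⟩, atRoot_qCyclotomic_mul_mul_pow (Nat.lt_succ_iff.mp hi)]
  obtain ⟨g, hg⟩ := exists_sum_eq_pow_mul h_odd fun i hi ↦
    ⟨_, .ite_halfPow h_odd hi (fun _ _ _ ↦ rfl) fun _ _ _ ↦ rfl, h_root i hi⟩
  refine ⟨g, ?_⟩
  rw [pow_add (p : ℚ), mul_right_comm, ← hg, sum_mul]
  refine sum_congr rfl fun k hk ↦ ?_
  simp only [hT]
  split_ifs with h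
  · rw [map_zero, mul_zero, zero_mul]
  · rw [← atOne_qHalfRatio h_odd, map_mul, map_pow, hc k ⟨not_le.mp h, mem_range.mp hk⟩, map_mul,
      atOne_qCyclotomic]
    ring

lemma ratModEq_ramanujanPartialSum_halfPow (h_odd : Odd p) {m : ℕ}
    (hm : m = halfPow p (t + 1) ∨ m = p ^ (t + 1) - 1) :
    RatModEq p (t + 1 + 4) (ramanujanPartialSum m) (ramanujanPartialSum (halfPow p (t + 1))) := by
  rcases hm with rfl | rfl
  · exact ratModEq_iff.mpr ⟨0, by simp⟩
  obtain ⟨g, hg⟩ := exists_sum_tail_eq_pow_mul h_odd t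
  have h_block := two_mul_halfPow_add_one h_odd (t + 1)
  refine ratModEq_iff.mpr ⟨g, ?_⟩
  rw [← hg, ramanujanPartialSum_eq_sum_halfRatio, ramanujanPartialSum_eq_sum_halfRatio,
    Nat.sub_add_cancel (show 1 ≤ p ^ (t + 1) by omega), sum_range_sub_sum_range (by omega),
    sum_filter]
  refine sum_congr rfl fun k _ ↦ ?_
  split_ifs <;> first | omega | simp

lemma halfRatio_sq_sub_pairRatio (h_odd : Odd p) {k : ℕ} (hk : k ≤ halfPow p (t + 1)) :
    halfRatio ℚ k ^ 2 - pairRatio (((halfPow p (t + 1) : ℚ) + 1 / 2) ^ 2) k =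
      halfRatio ℚ k ^ 2 * (p ^ 2 * atOne p (halfDeviation p t 1 k)) := by
  have h_block := two_mul_halfPow_add_one h_odd (t + 1)
  have h := pairRatio_eq_mul_one_sub (p := p) (t := t) (c := 1) (k := k) fun j hj ↦
    Nat.not_dvd_of_pos_of_lt (by omega) (by omega)
  rw [Nat.cast_one, mul_one, ← halfPow_add_half h_odd] at h
  linear_combination -h

lemma exists_sum_deviation_eq_pow_mul (h_odd : Odd p) (t : ℕ) : ∃ g,
    ∑ k ∈ range (halfPow p (t + 1) + 1), (-1 : ℚ) ^ k * (4 * k + 1) * (halfRatio ℚ k *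
      (halfRatio ℚ k ^ 2 - pairRatio (((halfPow p (t + 1) : ℚ) + 1 / 2) ^ 2) k) ^ 2) =
        (p : ℚ) ^ (t + 1 + 4) * atOne p g := by
  obtain ⟨g, hg⟩ := exists_sum_eq_pow_mul h_odd (s := t + 1)
    (T := fun k ↦ if k ≤ halfPow p (t + 1) then qHalfRatio p k ^ 5 * halfDeviation p t 1 k ^ 2
      else 0) fun i hi ↦
    ⟨_, .ite_halfPow h_odd hi (x := fun k ↦ atRoot p i (halfDeviation p t 1 k) ^ 2)
      (y := fun _ ↦ 0) (fun l r hr ↦ congrArg (· ^ 2)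
        (isBlockSymmetric_atRoot_halfDeviation h_odd (Nat.lt_succ_iff.mp hi) l r hr))
      fun _ _ _ ↦ rfl, fun k _ ↦ by split_ifs <;> simp⟩
  refine ⟨g, ?_⟩
  have h_block := two_mul_halfPow_add_one h_odd (t + 1)
  rw [pow_add (p : ℚ), mul_right_comm, ← hg, sum_mul]
  refine sum_subset_zero_on_sdiff (range_subset_range.mpr (by omega)) (fun k hk ↦ ?_) fun k hk ↦ ?_
  · have hk' : ¬ k ≤ halfPow p (t + 1) := by simp at hk; omega
    rw [if_neg hk', map_zero, mul_zero, zero_mul]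
  · have hk' : k ≤ halfPow p (t + 1) := Nat.lt_succ_iff.mp (mem_range.mp hk)
    rw [if_pos hk', halfRatio_sq_sub_pairRatio h_odd hk', map_mul, map_pow, map_pow,
      atOne_qHalfRatio h_odd]
    ring

lemma ratModEq_interpolation (h_odd : Odd p) {m : ℕ}
    (hm : m = halfPow p (t + 1) ∨ m = p ^ (t + 1) - 1) :
    RatModEq p (t + 1 + 4) (ramanujanPartialSum m) (2 * wellPoisedSum (halfPow p (t + 1)) 0 -
      wellPoisedSum (halfPow p (t + 1)) (((halfPow p (t + 1) : ℚ) + 1 / 2) ^ 2)) := by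
  obtain ⟨g, hg⟩ := exists_sum_deviation_eq_pow_mul h_odd t
  refine (ratModEq_ramanujanPartialSum_halfPow h_odd hm).trans (ratModEq_iff.mpr ⟨g, ?_⟩)
  rw [ramanujanPartialSum_eq_interpolation, add_sub_cancel_left, hg]

lemma atOne_sum_qQuotientSq_sub {N : ℕ} (hN : 4 * N < p ^ (t + 1)) :
    atOne p (∑ i ∈ range N,
        (qQuotientSq p t (2 * (2 * i + 1)) - qQuotientSq p t (2 * (2 * i + 2)))) =
      ((p : ℚ) ^ t) ^ 2 * (harmonicOrder 2 (2 * N) / 4 - harmonicOrder 2 N / 8) := by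
  rw [harmonicOrder_two_mul, mul_sum, map_sum]
  refine sum_congr rfl fun i hi ↦ ?_
  have h_not_dvd {m : ℕ} (h_pos : 0 < m) (h_le : m ≤ 4 * i + 4) : ¬ p ^ (t + 1) ∣ m :=
    Nat.not_dvd_of_pos_of_lt h_pos (by have := mem_range.mp hi; omega)
  rw [map_sub, atOne_qQuotientSq (h_not_dvd (by omega) (by omega)),
    atOne_qQuotientSq (h_not_dvd (by omega) (by omega))]
  ring

lemma exists_pairRatio_quarter_eq {N : ℕ} (hN : 4 * N < p ^ (t + 1)) :
    ∃ g, pairRatio (((p : ℚ) ^ (t + 1) / 4) ^ 2) N = halfRatio ℚ N ^ 2 *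
      (1 - ((p : ℚ) ^ (t + 1)) ^ 2 * (harmonicOrder 2 (2 * N) / 4 - harmonicOrder 2 N / 8) -
        (p : ℚ) ^ 4 * atOne p g) := by
  obtain ⟨g, hg⟩ := qCyclotomic_sq_dvd_halfDeviation_sub (p := p) (t := t) (c := 2) N
  have h_dev := congrArg (atOne p) hg
  rw [map_sub, atOne_sum_qQuotientSq_sub hN, map_mul, map_pow, atOne_qCyclotomic] at h_dev
  have h_pair := pairRatio_eq_mul_one_sub (p := p) (t := t) (c := 2) (k := N) fun j hj ↦
    Nat.not_dvd_of_pos_of_lt (by omega) (by omega)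
  rw [show 2 * ((2 : ℕ) : ℚ) = 4 by norm_num] at h_pair
  refine ⟨g, h_pair.trans ?_⟩
  linear_combination -halfRatio ℚ N ^ 2 * p ^ 2 * h_dev

lemma ratModEq_ramanujanPartialSum_of_eq_four_mul_add_one (h_odd : Odd p) {m N : ℕ}
    (hm : m = halfPow p (t + 1) ∨ m = p ^ (t + 1) - 1) (hN : p ^ (t + 1) = 4 * N + 1) :
    RatModEq p (t + 1 + 4) (ramanujanPartialSum m) (halfRatio ℚ N ^ 2 *
      ((p : ℚ) ^ (t + 1) + (p : ℚ) ^ (3 * (t + 1)) / 4 * harmonicOrder 2 (2 * N) -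
        (p : ℚ) ^ (3 * (t + 1)) / 8 * harmonicOrder 2 N)) := by
  have h_half : halfPow p (t + 1) = 2 * N := by rw [halfPow]; omega
  have h_cast : (p : ℚ) ^ (t + 1) = 4 * N + 1 := by exact_mod_cast hN
  obtain ⟨g, hg⟩ := exists_pairRatio_quarter_eq (p := p) (t := t) (N := N) (by omega)
  refine (ratModEq_interpolation h_odd hm).trans
    (ratModEq_iff.mpr ⟨qHalfRatio p N ^ 2 * g, ?_⟩)
  have h_quarter : (((2 * N : ℕ) : ℚ) + 1 / 2) ^ 2 / 4 = ((p : ℚ) ^ (t + 1) / 4) ^ 2 := by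
    rw [h_cast]; push_cast; ring
  rw [h_half, wellPoisedSum_even_zero, wellPoisedSum_even (add_one_sq_ne_add_half_sq _), h_quarter,
    hg, ← h_cast, map_mul, map_pow, atOne_qHalfRatio h_odd]
  ring

lemma ratModEq_ramanujanPartialSum_of_eq_four_mul_add_three (h_odd : Odd p) {m N : ℕ}
    (hm : m = halfPow p (t + 1) ∨ m = p ^ (t + 1) - 1) (hN : p ^ (t + 1) = 4 * N + 3) :
    RatModEq p (t + 1 + 4) (ramanujanPartialSum m) ((p : ℚ) ^ (2 * (t + 1)) *
      ∏ j ∈ range (2 * N + 1), (4 * (j : ℚ) + 3) / (4 * j + 5)) := by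
  have h_half : halfPow p (t + 1) = 2 * N + 1 := by rw [halfPow]; omega
  have h_cast : (p : ℚ) ^ (t + 1) = 4 * N + 3 := by exact_mod_cast hN
  have h := ratModEq_interpolation h_odd hm
  rwa [h_half, wellPoisedSum_odd_zero, wellPoisedSum_odd_half, ← h_cast, mul_zero, zero_sub,
    neg_mul, neg_neg, ← pow_mul'] at h

end Congruences

theorem corollary1p4 (p s m : ℕ) (hp : p.Prime) (hp2 : p ≠ 2) (hs : 1 ≤ s)
    (hm : m = (p ^ s - 1) / 2 ∨ m = p ^ s - 1) :
    (p ^ s ≡ 1 [MOD 4] →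
      RatModEq p (s + 4) (ramanujanPartialSum m)
        (shiftedFactorial (1 / 2) ((p ^ s - 1) / 4) ^ 2 /
            shiftedFactorial 1 ((p ^ s - 1) / 4) ^ 2 *
          ((p : ℚ) ^ s + (p : ℚ) ^ (3 * s) / 4 * harmonicOrder 2 ((p ^ s - 1) / 2)
            - (p : ℚ) ^ (3 * s) / 8 * harmonicOrder 2 ((p ^ s - 1) / 4)))) ∧
    (p ^ s ≡ 3 [MOD 4] →
      RatModEq p (s + 4) (ramanujanPartialSum m)
        ((p : ℚ) ^ (2 * s) *
          (shiftedFactorial (3 / 4) ((p ^ s - 1) / 2) /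
            shiftedFactorial (5 / 4) ((p ^ s - 1) / 2)))) := by
  have : Fact p.Prime := ⟨hp⟩
  have h_odd : Odd p := hp.odd_of_ne_two hp2
  obtain ⟨t, rfl⟩ := Nat.exists_eq_add_of_le' hs
  refine ⟨fun h_mod ↦ ?_, fun h_mod ↦ ?_⟩
  · obtain ⟨N, hN⟩ : ∃ N, p ^ (t + 1) = 4 * N + 1 := ⟨p ^ (t + 1) / 4, by
      rw [Nat.ModEq] at h_mod; omega⟩
    rw [show (p ^ (t + 1) - 1) / 2 = 2 * N by omega, show (p ^ (t + 1) - 1) / 4 = N by omega,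
      ← div_pow, shiftedFactorial_half_div_one]
    exact ratModEq_ramanujanPartialSum_of_eq_four_mul_add_one h_odd hm hN
  · obtain ⟨N, hN⟩ : ∃ N, p ^ (t + 1) = 4 * N + 3 := ⟨p ^ (t + 1) / 4, by
      rw [Nat.ModEq] at h_mod; omega⟩
    rw [show (p ^ (t + 1) - 1) / 2 = 2 * N + 1 by omega, shiftedFactorial_three_quarters_div]
    exact ratModEq_ramanujanPartialSum_of_eq_four_mul_add_three h_odd hm hN
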